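/- Setup. Let $n\ge 0$, let $X$ be a finite multiset of vectors in $\mathbb{R}^n$ (of any rank), and let $k:2^X\to\mathbb{N}$ be \emph{solid}: $\operatorname{Span}Z\subseteq\operatorname{Span}Z'$ implies $k(Z)\le k(Z')$ for $Z,Z'\subseteq X$. For an independent $I\subseteq X$ put $m(I)=k(I)+n-\#I$. Let $Y=(y_1,\dots,y_M)$ be a sequence of vectors in $\mathbb{R}^n$ with $M\ge m(I)$ for all independent $I\subseteq X$, in general position: no $y\in Y$ lies in the span of fewer than $n$ vectors of $(X\cup Y)\setminus y$. Write $X'=X\cup Y$, $Y_i=\{y_1,\dots,y_i\}$ (with $Y_i=Y$ if $i>M$), and let $\mathbb{B}_k$ be the set of all $B\subseteq X'$ that form a basis of $\mathbb{R}^n$ and satisfy $B\cap Y\subseteq Y_{m(B\cap X)}$. Let $\Pi=\mathbb{C}[t_1,\dots,t_n]$, and let $\Pi_j$ be the space of polynomials of degree at most $j$. Put $p_z(t)=z\cdot t$ for $z\in X'$, $p_Z=\prod_{z\in Z}p_z$, and $$P_k=\sum_{Z\subseteq X}p_{X\setminus Z}\,\Pi_{k(Z)},\qquad J_k=\operatorname{Ideal}\{p_Z: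 Z\subseteq X',\ Z\cap B\ne\emptyset\ \text{for all } B\in\mathbb{B}_k\},$$ $$D_k=\{f\in\Pi: p(D)f=0\ \text{for all } p\in J_k\},\qquad \langle p,f\rangle=(p(D)f)(0).$$ Homogeneous family. Given a total order on $X$, extend it to $X'$ by putting all of $X$ before $Y$ and keeping the given order of $Y$; for $B\in\mathbb{B}_k$ let $X'(B)=\{z\in X'\setminus B: z\notin\operatorname{Span}\{b\in B: b\prec z\}\}$. The family is $(p_{X'(B)})_{B\in\mathbb{B}_k}$. Lagrange family. Let $(\lambda_z)_{z\in X'}$ be real constants that are generic: with $q_z=p_z-\lambda_z$, no point of $\mathbb{R}^n$ is a common zero of $n+1$ of the polynomials $q_z$, $z\in X'$. For $B\in\mathbb{B}_k$ let $b(B)$ be the common zero of $q_z$, $z\in B$, and put $I=B\cap X$, $J=B\cap Y$, $I''=\{x\in I: k(I\setminus x)<k(I)\}$ and $Q_B=\prod_{z\in (X\cup Y_{m(I)})\setminus B}q_z$. If $m(I)<M$, let $y'=y_{m(I)+1}=\sum_{z\in B}a(z)z$ and $\ell_B=q_{y'}-\sum_{z\in I''\cup J}a(z)q_z$; if $m(I)=M$,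 let $\ell_B=1$. The family is $(L_B)_{B\in\mathbb{B}_k}$ with $L_B=Q_B\,\ell_B$. Theorem. (a) If $k$ is moreover incremental, i.e. $k(Z\cup x)\le k(Z)+1$ for all $Z\subseteq X$ and $x\in X$, then $\dim P_k=\#\mathbb{B}_k$. (b) Whenever $\dim P_k=\#\mathbb{B}_k$, the following hold: (i) $P_k\oplus J_k=\Pi$, and $P_k$ and $D_k$ are dual: $p\mapsto\langle p,\cdot\rangle$ is a linear bijection from $P_k$ onto the dual space of $D_k$. (ii) For every total order on $X$, the polynomials $p_{X'(B)}$, $B\in\mathbb{B}_k$, are homogeneous of degree $\#X'(B)$ and form a basis of $P_k$. (iii) For all generic constants $(\lambda_z)$, the polynomials $L_B$, $B\in\mathbb{B}_k$, form a basis of $P_k$, and $L_B(b(B'))=0$ if and only if $B'\ne B$, for $B,B'\in\mathbb{B}_k$. -/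

import Mathlib

open MvPolynomial

noncomputable section

namespace Zonotopal

/-! ### Vectors, spans, and bases.
Multisets of vectors are families indexed by a type; sub(multi)sets are finsets of indices. -/

/-- The linear span of the vectors of `V` with index in `Z`. -/
def spanOf {E : Type*} {n : ℕ} (V : E → Fin n → ℝ) (Z : Finset E) :
    Submodule ℝ (Fin n → ℝ) :=
  Submodule.span ℝ (V '' (Z : Set E))

/-- `I` indexes a linearly independent subfamily. -/
def IsIndep {E : Type*} {n : ℕ} (V : E → Fin n → ℝ) (I : Finset E) : Prop :=
  LinearIndependent ℝ (fun z : {z // z ∈ I} => V z)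

/-- `B` indexes a basis of `ℝⁿ`. -/
structure IsBasis {E : Type*} {n : ℕ} (V : E → Fin n → ℝ) (B : Finset E) : Prop where
  indep : IsIndep V B
  spans : ⊤ ≤ Submodule.span ℝ (Set.range fun z : {z // z ∈ B} => V z)

/-- The basis of `ℝⁿ` indexed by `B`. -/
def IsBasis.basis {E : Type*} {n : ℕ} {V : E → Fin n → ℝ} {B : Finset E} (h : IsBasis V B) :
    Module.Basis {z // z ∈ B} ℝ (Fin n → ℝ) :=
  Module.Basis.mk h.indep h.spans

/-! ### Linear forms, differential operators, the pairing -/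

/-- The linear form `p_x : t ↦ x · t` as a complex polynomial. -/
def linForm {n : ℕ} (x : Fin n → ℝ) : MvPolynomial (Fin n) ℂ :=
  ∑ i, C (x i : ℂ) * X i

/-- `p_Z = ∏_{z ∈ Z} p_z`. -/
def pProd {E : Type*} {n : ℕ} (V : E → Fin n → ℝ) (Z : Finset E) : MvPolynomial (Fin n) ℂ :=
  ∏ z ∈ Z, linForm (V z)

/-- `q_z = p_z - c_z`. -/
def affForm {E : Type*} {n : ℕ} (V : E → Fin n → ℝ) (c : E → ℝ) (z : E) :
    MvPolynomial (Fin n) ℂ :=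
  linForm (V z) - C (c z : ℂ)

/-- `q_Z = ∏_{z ∈ Z} q_z`. -/
def qProd {E : Type*} {n : ℕ} (V : E → Fin n → ℝ) (c : E → ℝ) (Z : Finset E) :
    MvPolynomial (Fin n) ℂ :=
  ∏ z ∈ Z, affForm V c z

/-- The value of a complex polynomial at a real point. -/
def evalAt {n : ℕ} (v : Fin n → ℝ) (f : MvPolynomial (Fin n) ℂ) : ℂ :=
  eval (fun i => (v i : ℂ)) f

/-- The constant coefficient differential operator `p(D)`, linear in `p`; the monomial `t^d` acts
as `∂₁^{d₁} ⋯ ∂ₙ^{dₙ}`. -/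
def diffOp (n : ℕ) :
    MvPolynomial (Fin n) ℂ →ₗ[ℂ] Module.End ℂ (MvPolynomial (Fin n) ℂ) :=
  (basisMonomials (Fin n) ℂ).constr ℂ fun d =>
    (List.ofFn fun i : Fin n =>
      ((pderiv i).toLinearMap : Module.End ℂ (MvPolynomial (Fin n) ℂ)) ^ d i).prod

/-- The pairing `⟨p, f⟩ = (p(D) f)(0)`. -/
def pairing (n : ℕ) :
    MvPolynomial (Fin n) ℂ →ₗ[ℂ] MvPolynomial (Fin n) ℂ →ₗ[ℂ] ℂ :=
  LinearMap.compr₂ (diffOp n) (lcoeff ℂ 0)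

/-! ### Assignments, the basis set, and the two polynomial spaces -/

/-- `k` is solid: `Span Z ⊆ Span Z'` implies `k Z ≤ k Z'`. -/
def Solid {ι : Type*} {n : ℕ} (x : ι → Fin n → ℝ) (k : Finset ι → ℕ) : Prop :=
  ∀ Z Z' : Finset ι, spanOf x Z ≤ spanOf x Z' → k Z ≤ k Z'

/-- `k` is incremental: adding one vector raises `k` by at most one. -/
def Incremental {ι : Type*} [DecidableEq ι] (k : Finset ι → ℕ) : Prop :=
  ∀ (Z : Finset ι) (a : ι), k (insert a Z) ≤ k Z + 1

/-- `m(I) = k(I) + n - #I` (used for independent `I`, where `#I ≤ n`). -/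
def extNum {ι : Type*} (n : ℕ) (k : Finset ι → ℕ) (I : Finset ι) : ℕ :=
  k I + (n - I.card)

/-- The family `X ∪ Y`. -/
abbrev joint {ι : Type*} {n M : ℕ} (x : ι → Fin n → ℝ) (y : Fin M → Fin n → ℝ) :
    ι ⊕ Fin M → Fin n → ℝ :=
  Sum.elim x y

/-- No vector of `Y` is in the span of fewer than `n` other vectors of `X ∪ Y`. -/
def GeneralPosition {ι : Type*} {n M : ℕ} (x : ι → Fin n → ℝ) (y : Fin M → Fin n → ℝ) : Prop :=
  ∀ (j : Fin M) (S : Finset (ι ⊕ Fin M)), Sum.inr j ∉ S → S.card < n →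
    y j ∉ spanOf (joint x y) S

/-- `Y` has length at least `m(I)` for every independent `I ⊆ X`. -/
def LongEnough {ι : Type*} {n : ℕ} (x : ι → Fin n → ℝ) (k : Finset ι → ℕ) (M : ℕ) : Prop :=
  ∀ I : Finset ι, IsIndep x I → extNum n k I ≤ M

/-- `𝔹_k`: the bases `B` of `X ∪ Y` with `B ∩ Y ⊆ Y_{m(B ∩ X)}`, where `Y_i` consists of the first
`i` vectors of `Y`. -/
def basisSet {ι : Type*} {n M : ℕ} (x : ι → Fin n → ℝ) (y : Fin M → Fin n → ℝ)
    (k : Finset ι → ℕ) : Set (Finset (ι ⊕ Fin M)) :=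
  {B | IsBasis (joint x y) B ∧ ∀ j ∈ B.toRight, (j : ℕ) < extNum n k B.toLeft}

/-- `P_k = ∑_{Z ⊆ X} p_{X ∖ Z} Π_{k(Z)}`. -/
def pSpace {ι : Type*} [Fintype ι] [DecidableEq ι] {n : ℕ} (x : ι → Fin n → ℝ)
    (k : Finset ι → ℕ) : Submodule ℂ (MvPolynomial (Fin n) ℂ) :=
  ⨆ Z : Finset ι,
    (restrictTotalDegree (Fin n) ℂ (k Z)).map (LinearMap.mulLeft ℂ (pProd x (Finset.univ \ Z)))

/-- `J_k`: the ideal generated by the `p_Z`, `Z ⊆ X ∪ Y` meeting every `B ∈ 𝔹_k`. -/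
def jIdeal {ι : Type*} {n M : ℕ} (x : ι → Fin n → ℝ) (y : Fin M → Fin n → ℝ)
    (k : Finset ι → ℕ) : Ideal (MvPolynomial (Fin n) ℂ) :=
  Ideal.span {f | ∃ Z : Finset (ι ⊕ Fin M),
    (∀ B ∈ basisSet x y k, ∃ z ∈ Z, z ∈ B) ∧ f = pProd (joint x y) Z}

/-- `D_k`: the polynomials annihilated by `p(D)` for all `p ∈ J_k`. -/
def dSpace {ι : Type*} {n M : ℕ} (x : ι → Fin n → ℝ) (y : Fin M → Fin n → ℝ)
    (k : Finset ι → ℕ) : Submodule ℂ (MvPolynomial (Fin n) ℂ) :=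
  ⨅ p ∈ jIdeal x y k, LinearMap.ker (diffOp n p)

/-- The family `f` is a basis of the subspace `W`. -/
def IsBasisOf {κ W : Type*} [AddCommGroup W] [Module ℂ W] (f : κ → W) (P : Submodule ℂ W) :
    Prop :=
  LinearIndependent ℂ f ∧ Submodule.span ℂ (Set.range f) = P

/-! ### The homogeneous family -/

open scoped Classical in
/-- `X'(B)`: the `z ∈ X' ∖ B` not in the span of the `b ∈ B` with `b ≺ z`, where `X' = X ∪ Y` is
ordered by `r` on `X`, by the given order on `Y`, and with all of `X` before `Y`. -/
def activeSet {ι : Type*} [Fintype ι] {n M : ℕ} (x : ι → Fin n → ℝ) (y : Fin M → Fin n → ℝ)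
    (r : ι → ι → Prop) (B : Finset (ι ⊕ Fin M)) : Finset (ι ⊕ Fin M) :=
  Finset.univ.filter fun z =>
    z ∉ B ∧ joint x y z ∉ spanOf (joint x y) (B.filter fun b => Sum.Lex r (· < ·) b z)

/-! ### The Lagrange family -/

/-- No point of `ℝⁿ` is a common zero of `n + 1` of the polynomials `q_z`. -/
def Generic {E : Type*} {n : ℕ} (V : E → Fin n → ℝ) (c : E → ℝ) : Prop :=
  ∀ S : Finset E, S.card = n + 1 → ¬ ∃ v : Fin n → ℝ, ∀ z ∈ S, evalAt v (affForm V c z) = 0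

/-- The vertex `b(B)`: the common zero of the `q_z`, `z ∈ B`. Its coordinates are the values at the
unit vectors of the linear functional that takes the value `c z` at each `z ∈ B`. -/
def IsBasis.vertex {E : Type*} {n : ℕ} {V : E → Fin n → ℝ} {B : Finset E} (h : IsBasis V B)
    (c : E → ℝ) : Fin n → ℝ :=
  fun i => h.basis.constr ℝ (fun z => c z) (Pi.single i 1)

theorem evalAt_affForm {E : Type*} {n : ℕ} (V : E → Fin n → ℝ) (c : E → ℝ) (z : E)
    (v : Fin n → ℝ) : evalAt v (affForm V c z) = ((V z ⬝ᵥ v - c z : ℝ) : ℂ) := by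
  simp [evalAt, affForm, linForm, dotProduct]

theorem IsBasis.eq_vertex_iff {E : Type*} {n : ℕ} {V : E → Fin n → ℝ} {B : Finset E}
    (h : IsBasis V B) (c : E → ℝ) (v : Fin n → ℝ) :
    v = h.vertex c ↔ ∀ z ∈ B, evalAt v (affForm V c z) = 0 := by
  have key : ∀ (f : (Fin n → ℝ) →ₗ[ℝ] ℝ) (w : Fin n → ℝ),
      f w = w ⬝ᵥ fun i => f (Pi.single i 1) := by
    intro f w
    rw [LinearMap.pi_apply_eq_sum_univ f w]
    refine Finset.sum_congr rfl fun i _ => ?_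
    have hi : (fun j => if i = j then (1 : ℝ) else 0) = Pi.single i 1 := by
      funext j
      simp [Pi.single_apply, eq_comm]
    rw [hi, smul_eq_mul]
  have hb : ∀ z : {z // z ∈ B}, h.basis z = V z := fun z =>
    Module.Basis.mk_apply h.indep h.spans z
  simp only [evalAt_affForm, Complex.ofReal_eq_zero, sub_eq_zero]
  constructor
  · rintro rfl z hz
    have := h.basis.constr_basis ℝ (fun z => c z) ⟨z, hz⟩
    rw [hb, key] at this
    exact this
  · intro hv
    let g : (Fin n → ℝ) →ₗ[ℝ] ℝ :=
      { toFun := fun w => w ⬝ᵥ v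
        map_add' := fun a b => add_dotProduct a b v
        map_smul' := fun a b => smul_dotProduct a b v }
    have hg : h.basis.constr ℝ (fun z => c z) = g := by
      refine h.basis.ext fun z => ?_
      rw [h.basis.constr_basis, hb]
      exact (hv z z.2).symm
    funext i
    simp only [IsBasis.vertex, hg]
    exact (single_one_dotProduct i v).symm

/-- `Q_B = q_{X_B ∖ B}` with `X_B = X ∪ Y_{m(B ∩ X)}`. -/
def lagrangeQ {ι : Type*} [Fintype ι] [DecidableEq ι] {n M : ℕ} (x : ι → Fin n → ℝ)
    (y : Fin M → Fin n → ℝ) (k : Finset ι → ℕ) (c : ι ⊕ Fin M → ℝ) (B : Finset (ι ⊕ Fin M)) :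
    MvPolynomial (Fin n) ℂ :=
  qProd (joint x y) c
    ((Finset.univ.disjSum
      (Finset.univ.filter fun j : Fin M => (j : ℕ) < extNum n k B.toLeft)) \ B)

/-- `I'' ∪ J`, where `I = B ∩ X`, `I'' = {a ∈ I | k(I ∖ a) < k(I)}` and `J = B ∩ Y`. -/
def lagrangeSupport {ι : Type*} [DecidableEq ι] {M : ℕ} (k : Finset ι → ℕ)
    (B : Finset (ι ⊕ Fin M)) : Finset (ι ⊕ Fin M) :=
  (B.toLeft.filter fun a => k (B.toLeft.erase a) < k B.toLeft).disjSum B.toRight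

/-- `ℓ_B = q_{y'} - ∑_{z ∈ I'' ∪ J} a(z) q_z`, where `y' = y_{m(B ∩ X) + 1}` (which has index
`m(B ∩ X)` here, as indices start at `0`) and `y' = ∑_{z ∈ B} a(z) z`. If `Y` has only `m(B ∩ X)`
elements, so that there is no `y'`, then `ℓ_B = 1`. -/
def lagrangeL {ι : Type*} [DecidableEq ι] {n M : ℕ} (x : ι → Fin n → ℝ)
    (y : Fin M → Fin n → ℝ) (k : Finset ι → ℕ) (c : ι ⊕ Fin M → ℝ) (B : Finset (ι ⊕ Fin M))
    (hB : IsBasis (joint x y) B) : MvPolynomial (Fin n) ℂ :=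
  if h : extNum n k B.toLeft < M then
    affForm (joint x y) c (Sum.inr ⟨extNum n k B.toLeft, h⟩) -
      ∑ z : {z // z ∈ B}, if (z : ι ⊕ Fin M) ∈ lagrangeSupport k B then
        C ((hB.basis.repr (y ⟨extNum n k B.toLeft, h⟩) z : ℝ) : ℂ) * affForm (joint x y) c z
      else 0
  else 1

/-- `L_B = Q_B ℓ_B`, `B ∈ 𝔹_k`. -/
def lagrange {ι : Type*} [Fintype ι] [DecidableEq ι] {n M : ℕ} (x : ι → Fin n → ℝ)
    (y : Fin M → Fin n → ℝ) (k : Finset ι → ℕ) (c : ι ⊕ Fin M → ℝ)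
    (B : {B // B ∈ basisSet x y k}) : MvPolynomial (Fin n) ℂ :=
  lagrangeQ x y k c B * lagrangeL x y k c B B.2.1

end Zonotopal

end

/-! Both parts rest on one fact, valid without incrementality: for every order, the products
p_{X'(B)}, B ∈ 𝔹_k, form a basis of a complement of J_k in Π, and this complement lies in P_k.

They span modulo J_k because, by deletion and contraction (`le_sup_minor`), the products over all
bases of X' span modulo the ideal of the p_Z with Z meeting every basis. If B is a basis outside
𝔹_k, then X'(B) meets every member of 𝔹_k (`exists_mem_activeSet`), so its product is in J_k and can
be dropped. They are independent modulo J_k because the codimension of J_k is at least #𝔹_k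
(`card_le_of_span_sup_jIdeal`): replacing each generator p_Z by q_Z keeps leading forms, hence keeps
spanning, while the q_Z vanish at the #𝔹_k distinct vertices b(B), where polynomials take arbitrary
values.

If dim P_k = #𝔹_k, the complement is therefore P_k itself. Duality follows since D_k is the
annihilator of J_k and J_k contains all monomials of large degree. The Lagrange polynomials lie in
P_k, and counting shows that they are dual, up to nonzero factors, to the vertices; there are dim
P_k of them.

For (a) it remains to bound P_k from above. Incrementality bounds the degree of the members of P_k
along lines with direction η by k(X ∩ η^⊥) + #(X ∖ η^⊥). Directional bounds of this kind survive
deletion and contraction, and an induction (`mem_minorSpan_sup_of_head` for X,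
`mem_minorSpan_sup_of_tail` for Y) shows that every polynomial satisfying them is in the span of the
p_{X'(B)}, B ∈ 𝔹_k. -/

namespace Zonotopal

/-! ### Spans and bases of indexed families, linear forms, active elements -/

section Basics

variable {E : Type*} {n : ℕ} {V : E → Fin n → ℝ}

theorem mem_spanOf {Z : Finset E} {z : E} (h : z ∈ Z) : V z ∈ spanOf V Z :=
  Submodule.subset_span ⟨z, h, rfl⟩

theorem spanOf_mono {Z Z' : Finset E} (h : Z ⊆ Z') : spanOf V Z ≤ spanOf V Z' :=
  Submodule.span_mono (Set.image_mono (Finset.coe_subset.2 h))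

theorem spanOf_le {Z : Finset E} {W : Submodule ℝ (Fin n → ℝ)} :
    spanOf V Z ≤ W ↔ ∀ z ∈ Z, V z ∈ W := by
  simp [spanOf, Submodule.span_le, Set.subset_def]

theorem isIndep_iff {I : Finset E} : IsIndep V I ↔ LinearIndepOn ℝ V (I : Set E) := Iff.rfl

theorem IsIndep.mono {I I' : Finset E} (h : IsIndep V I) (hI : I' ⊆ I) : IsIndep V I' :=
  LinearIndepOn.mono (isIndep_iff.1 h) (Finset.coe_subset.2 hI)

theorem isIndep_empty : IsIndep V ∅ := by
  rw [isIndep_iff, Finset.coe_empty]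
  exact linearIndepOn_empty ℝ V

theorem IsIndep.insert [DecidableEq E] {I : Finset E} (h : IsIndep V I) {a : E}
    (ha : V a ∉ spanOf V I) : IsIndep V (insert a I) := by
  rw [isIndep_iff, Finset.coe_insert]
  exact LinearIndepOn.insert h ha

theorem IsIndep.notMem_spanOf {I C : Finset E} (h : IsIndep V I) {a : E} (ha : a ∈ I)
    (hC : C ⊆ I) (haC : a ∉ C) : V a ∉ spanOf V C :=
  LinearIndepOn.notMem_span_of_insert (s := (C : Set E))
    (LinearIndepOn.mono (isIndep_iff.1 h)
      (Set.insert_subset ha (Finset.coe_subset.2 hC))) haC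

theorem spanOf_eq_span_range (I : Finset E) :
    spanOf V I = Submodule.span ℝ (Set.range fun z : {z // z ∈ I} => V z) := by
  rw [spanOf]
  congr 1
  ext v
  simp

theorem IsIndep.finrank_spanOf {I : Finset E} (h : IsIndep V I) :
    Module.finrank ℝ (spanOf V I) = I.card := by
  rw [spanOf_eq_span_range, finrank_span_eq_card h, Fintype.card_coe]

theorem finrank_spanOf_le (Z : Finset E) : Module.finrank ℝ (spanOf V Z) ≤ Z.card := by
  rw [spanOf_eq_span_range]
  exact (finrank_range_le_card _).trans (Fintype.card_coe Z).le

theorem IsIndep.card_le_of_spanOf_le {I Z : Finset E} (h : IsIndep V I)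
    (hI : spanOf V I ≤ spanOf V Z) : I.card ≤ Z.card :=
  h.finrank_spanOf.symm.le.trans ((Submodule.finrank_mono hI).trans (finrank_spanOf_le Z))

theorem IsIndep.card_le {I : Finset E} (h : IsIndep V I) : I.card ≤ n := by
  simpa [h.finrank_spanOf] using Submodule.finrank_le (spanOf V I)

theorem IsBasis.spanOf_eq_top {B : Finset E} (h : IsBasis V B) : spanOf V B = ⊤ := by
  rw [spanOf_eq_span_range]
  exact top_le_iff.1 h.spans

theorem IsBasis.basis_apply {B : Finset E} (h : IsBasis V B) (z : {z // z ∈ B}) :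
    h.basis z = V z :=
  Module.Basis.mk_apply h.indep h.spans z

theorem IsBasis.card_eq {B : Finset E} (h : IsBasis V B) : B.card = n := by
  rw [← h.indep.finrank_spanOf, h.spanOf_eq_top]
  simp

theorem IsIndep.isBasis {B : Finset E} (h : IsIndep V B) (hc : B.card = n) : IsBasis V B := by
  refine ⟨h, ?_⟩
  rw [← spanOf_eq_span_range]
  refine (Submodule.eq_top_of_finrank_eq ?_).ge
  simp [h.finrank_spanOf, hc]

theorem IsIndep.exists_isBasis {I S : Finset E} (hI : IsIndep V I) (hIS : I ⊆ S)
    (hS : spanOf V S = ⊤) : ∃ B, I ⊆ B ∧ B ⊆ S ∧ IsBasis V B := by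
  obtain ⟨b, hbS, hIb, hsp, hb⟩ := exists_linearIndepOn_extension hI (Finset.coe_subset.2 hIS)
  lift b to Finset E using S.finite_toSet.subset hbS
  refine ⟨b, Finset.coe_subset.1 hIb, Finset.coe_subset.1 hbS, hb, ?_⟩
  rw [← spanOf_eq_span_range, ← hS]
  exact Submodule.span_le.2 hsp

/-! ### Linear forms -/

/-- The linear form `p_x`, as a linear function of `x`. -/
noncomputable def linFormₗ (n : ℕ) : (Fin n → ℝ) →ₗ[ℝ] MvPolynomial (Fin n) ℂ where
  toFun := linForm
  map_add' a b := by
    simp [linForm, add_mul, Finset.sum_add_distrib]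
  map_smul' c a := by
    rw [RingHom.id_apply, linForm, linForm, Finset.smul_sum]
    refine Finset.sum_congr rfl fun i _ => ?_
    ext m
    simp [coeff_C_mul, mul_assoc]

@[simp] theorem linFormₗ_apply (x : Fin n → ℝ) : linFormₗ n x = linForm x := rfl

theorem isHomogeneous_linForm (x : Fin n → ℝ) : (linForm x).IsHomogeneous 1 := by
  refine IsHomogeneous.sum _ _ _ fun i _ => ?_
  simpa using (isHomogeneous_C (Fin n) (x i : ℂ)).mul (isHomogeneous_X ℂ i)

theorem isHomogeneous_pProd (V : E → Fin n → ℝ) (Z : Finset E) :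
    (pProd V Z).IsHomogeneous Z.card := by
  simpa [pProd] using IsHomogeneous.prod Z (fun z => linForm (V z)) (fun _ => 1)
    fun z _ => isHomogeneous_linForm (V z)

theorem linForm_mem_ideal {C : Finset E} {v : Fin n → ℝ} (hv : v ∈ spanOf V C)
    {K : Ideal (MvPolynomial (Fin n) ℂ)} (hK : ∀ c ∈ C, linForm (V c) ∈ K) : linForm v ∈ K := by
  have : spanOf V C ≤ ((K.restrictScalars ℝ).comap (linFormₗ n)) := by
    rw [spanOf_le]
    exact hK
  exact this hv

theorem linForm_single (i : Fin n) : linForm (Pi.single i (1 : ℝ)) = X i := by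
  rw [linForm, Finset.sum_eq_single i]
  · simp
  · intro j _ hj
    simp [hj]
  · simp

/-- Modulo an ideal containing the linear forms of a spanning set, all polynomials are constant. -/
theorem sub_C_mem_ideal {C : Finset E} (hC : spanOf V C = ⊤)
    {K : Ideal (MvPolynomial (Fin n) ℂ)} (hK : ∀ c ∈ C, linForm (V c) ∈ K)
    (f : MvPolynomial (Fin n) ℂ) : f - MvPolynomial.C (constantCoeff f) ∈ K := by
  have hX : ∀ i, (X i : MvPolynomial (Fin n) ℂ) ∈ K := fun i => by
    rw [← linForm_single]
    exact linForm_mem_ideal (hC ▸ Submodule.mem_top) hK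
  induction f using MvPolynomial.induction_on with
  | C a => simp
  | add p q hp hq =>
    have := K.add_mem hp hq
    convert this using 1
    rw [map_add, map_add]
    ring
  | mul_X p i _ => simpa using K.mul_mem_left p (hX i)

/-! ### Active elements -/

open scoped Classical in
/-- The `z ∈ L ∖ B` not in the span of the `b ∈ B` that precede `z`. -/
noncomputable def activeIn (V : E → Fin n → ℝ) (s : E → E → Prop) (L B : Finset E) : Finset E :=
  L.filter fun z => z ∉ B ∧ V z ∉ spanOf V (B.filter fun b => s b z)

theorem mem_activeIn {s : E → E → Prop} {L B : Finset E} {z : E} : z ∈ activeIn V s L B ↔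
    z ∈ L ∧ z ∉ B ∧ ∃ C : Finset E, (∀ b, b ∈ C ↔ b ∈ B ∧ s b z) ∧ V z ∉ spanOf V C := by
  classical
  simp only [activeIn, Finset.mem_filter]
  refine and_congr_right fun _ => and_congr_right fun _ => ⟨fun h => ⟨_, ?_, h⟩, ?_⟩
  · simp
  · rintro ⟨C, hC, h⟩
    convert h
    ext b
    simp [hC]

theorem activeIn_erase_of_notMem [DecidableEq E] {s : E → E → Prop} {L B : Finset E} {a : E}
    (ha : a ∉ activeIn V s L B) : activeIn V s (L.erase a) B = activeIn V s L B := by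
  classical
  ext z
  have h1 : z ∈ activeIn V s (L.erase a) B ↔ z ≠ a ∧ z ∈ activeIn V s L B := by
    simp only [activeIn, Finset.mem_filter, Finset.mem_erase]; tauto
  rw [h1]
  exact ⟨fun h => h.2, fun h => ⟨fun e => ha (e ▸ h), h⟩⟩

theorem pProd_activeIn_of_mem [DecidableEq E] {s : E → E → Prop} {L B : Finset E} {a : E}
    (ha : a ∈ activeIn V s L B) :
    pProd V (activeIn V s L B) = linForm (V a) * pProd V (activeIn V s (L.erase a) B) := by
  classical
  rw [pProd, pProd, ← Finset.mul_prod_erase _ _ ha]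
  congr 2
  ext z
  simp only [activeIn, Finset.mem_filter, Finset.mem_erase]; tauto

/-- `L` is closed upwards with respect to `s`. -/
def IsUpper (s : E → E → Prop) (L : Finset E) : Prop := ∀ e ∉ L, ∀ w ∈ L, s e w

/-- `a` is the least element of the upper set `L`. -/
structure IsLeast' (s : E → E → Prop) (L : Finset E) (a : E) : Prop where
  mem : a ∈ L
  lt : ∀ w ∈ L, w ≠ a → s a w

theorem exists_isLeast' (s : E → E → Prop) [IsStrictTotalOrder E s] {L : Finset E}
    (hL : L.Nonempty) : ∃ a, IsLeast' s L a := by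
  classical
  induction hL using Finset.Nonempty.cons_induction with
  | singleton a => exact ⟨a, by simp, by simp⟩
  | cons a t ha ht ih =>
    obtain ⟨b, hb⟩ := ih
    rcases trichotomous_of s a b with h | h | h
    · refine ⟨a, by simp, fun w hw hwa => ?_⟩
      rcases Finset.mem_cons.1 hw with rfl | hw
      · exact absurd rfl hwa
      · by_cases hwb : w = b
        · exact hwb ▸ h
        · exact _root_.trans h (hb.lt w hw hwb)
    · exact absurd (h ▸ hb.mem) ha
    · refine ⟨b, by simp [hb.mem], fun w hw hwb => ?_⟩
      rcases Finset.mem_cons.1 hw with rfl | hw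
      · exact h
      · exact hb.lt w hw hwb

theorem IsUpper.erase [DecidableEq E] {s : E → E → Prop} {L : Finset E} (hL : IsUpper s L) {a : E}
    (ha : IsLeast' s L a) : IsUpper s (L.erase a) := by
  intro e he w hw
  rw [Finset.mem_erase] at hw he
  by_cases hea : e = a
  · exact hea ▸ ha.lt w hw.2 hw.1
  · exact hL e (fun h => he ⟨hea, h⟩) w hw.2

/-- The least element `a` of `L` is active exactly if it is not in `B` and not in the span of the
part `C` of `B` below `L`. -/
theorem isLeast_mem_activeIn {s : E → E → Prop} [IsStrictTotalOrder E s] {L B C : Finset E}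
    (hL : IsUpper s L) {a : E} (ha : IsLeast' s L a) (hC : ∀ e, e ∈ C ↔ e ∈ B ∧ e ∉ L) :
    a ∈ activeIn V s L B ↔ a ∉ B ∧ V a ∉ spanOf V C := by
  classical
  have : (B.filter fun b => s b a) = C := by
    ext b
    rw [Finset.mem_filter, hC]
    refine and_congr_right fun _ => ⟨fun h hb => ?_, fun h => hL b h a ha.mem⟩
    by_cases hba : b = a
    · exact irrefl_of s a (hba ▸ h)
    · exact asymm_of s h (ha.lt b hb hba)
  rw [activeIn, Finset.mem_filter, ← this]
  exact ⟨fun h => by convert h.2, fun h => ⟨ha.mem, by convert h⟩⟩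

end Basics

/-! ### Deletion and contraction for the set of all bases -/

section Central

variable {E : Type*} {n : ℕ} {V : E → Fin n → ℝ}

/-- The ideal generated by the linear forms of `C` and by the products `p_Z`, `Z ⊆ L`, for which `Z`
meets every basis `B` with `B ∖ L = C`. -/
noncomputable def minorIdeal (V : E → Fin n → ℝ) (L C : Finset E) : Ideal (MvPolynomial (Fin n) ℂ) :=
  Ideal.span ({f | ∃ c ∈ C, f = linForm (V c)} ∪
    {f | ∃ Z ⊆ L, (∀ B, IsBasis V B → (∀ e, e ∈ C ↔ e ∈ B ∧ e ∉ L) → ∃ z ∈ Z, z ∈ B) ∧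
      f = pProd V Z})

/-- The span of the products over the active elements in `L`, for `B ∈ 𝔹` with `B ∖ L = C`. -/
noncomputable def minorSpan (V : E → Fin n → ℝ) (s : E → E → Prop) (𝔹 : Set (Finset E))
    (L C : Finset E) : Submodule ℂ (MvPolynomial (Fin n) ℂ) :=
  Submodule.span ℂ {f | ∃ B ∈ 𝔹, (∀ e, e ∈ C ↔ e ∈ B ∧ e ∉ L) ∧
    f = pProd V (activeIn V s L B)}

theorem linForm_mem_minorIdeal {L C : Finset E} {c : E} (hc : c ∈ C) :
    linForm (V c) ∈ minorIdeal V L C :=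
  Ideal.subset_span (Or.inl ⟨c, hc, rfl⟩)

theorem pProd_mem_minorIdeal {L C Z : Finset E} (hZ : Z ⊆ L)
    (h : ∀ B, IsBasis V B → (∀ e, e ∈ C ↔ e ∈ B ∧ e ∉ L) → ∃ z ∈ Z, z ∈ B) :
    pProd V Z ∈ minorIdeal V L C :=
  Ideal.subset_span (Or.inr ⟨Z, hZ, h, rfl⟩)

theorem mem_minorSpan {s : E → E → Prop} {𝔹 : Set (Finset E)} {L B C : Finset E} (hB : B ∈ 𝔹)
    (h : ∀ e, e ∈ C ↔ e ∈ B ∧ e ∉ L) : pProd V (activeIn V s L B) ∈ minorSpan V s 𝔹 L C :=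
  Submodule.subset_span ⟨B, hB, h, rfl⟩

variable [DecidableEq E]

/-- Restricting the part of a basis below `L` when `L` loses an element outside of the basis. -/
theorem below_erase_of_notMem {L B C : Finset E} {a : E} (ha : a ∉ B) :
    (∀ e, e ∈ C ↔ e ∈ B ∧ e ∉ L.erase a) ↔ ∀ e, e ∈ C ↔ e ∈ B ∧ e ∉ L := by
  refine forall_congr' fun e => iff_congr Iff.rfl (and_congr_right fun he => ?_)
  have : e ≠ a := fun h => ha (h ▸ he)
  simp [this]

theorem below_erase_of_mem {L B C : Finset E} {a : E} (haL : a ∈ L) (ha : a ∈ B) (hC : Disjoint C L) :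
    (∀ e, e ∈ insert a C ↔ e ∈ B ∧ e ∉ L.erase a) ↔ ∀ e, e ∈ C ↔ e ∈ B ∧ e ∉ L := by
  have haC : a ∉ C := fun h => Finset.disjoint_left.1 hC h haL
  refine forall_congr' fun e => ?_
  by_cases h : e = a
  · subst h
    simp [haL, ha, haC]
  · simp [h]

section Minor

variable {s : E → E → Prop} [IsStrictTotalOrder E s] {𝔹 : Set (Finset E)} {L C : Finset E} {a : E}

theorem below_erase_of_mem_spanOf {B : Finset E} (hB : IsBasis V B) (hd : Disjoint C L)
    (haL : a ∈ L) (hsp : V a ∈ spanOf V C) (h : ∀ e, e ∈ C ↔ e ∈ B ∧ e ∉ L.erase a) :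
    ∀ e, e ∈ C ↔ e ∈ B ∧ e ∉ L :=
  (below_erase_of_notMem fun haB => hB.indep.notMem_spanOf haB (fun e he => ((h e).1 he).1)
    (fun haC => Finset.disjoint_left.1 hd haC haL) hsp).1 h

theorem minorSpan_erase_le_of_mem_spanOf (h𝔹 : ∀ B ∈ 𝔹, IsBasis V B) (hL : IsUpper s L)
    (ha : IsLeast' s L a) (hd : Disjoint C L) (hsp : V a ∈ spanOf V C) :
    minorSpan V s 𝔹 (L.erase a) C ≤ minorSpan V s 𝔹 L C := by
  refine Submodule.span_le.2 ?_
  rintro f ⟨B, hB, h, rfl⟩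
  have h' := below_erase_of_mem_spanOf (h𝔹 B hB) hd ha.mem hsp h
  rw [activeIn_erase_of_notMem fun h'' => ((isLeast_mem_activeIn hL ha h').1 h'').2 hsp]
  exact mem_minorSpan hB h'

theorem minorSpan_erase_insert_le (hL : IsUpper s L) (ha : IsLeast' s L a) (hd : Disjoint C L) :
    minorSpan V s 𝔹 (L.erase a) (insert a C) ≤ minorSpan V s 𝔹 L C := by
  refine Submodule.span_le.2 ?_
  rintro f ⟨B, hB, h, rfl⟩
  have haB : a ∈ B := ((h a).1 (Finset.mem_insert_self a C)).1
  rw [below_erase_of_mem ha.mem haB hd] at h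
  rw [activeIn_erase_of_notMem fun h' => ((isLeast_mem_activeIn hL ha h).1 h').1 haB]
  exact mem_minorSpan hB h

/-- Deleting a from L removes exactly the factor p_a from each generator: a basis with part C below
the smaller set avoids a, and a is active for it because it is outside Span C. -/
theorem linForm_mul_mem_minorSpan (hL : IsUpper s L) (ha : IsLeast' s L a) (hd : Disjoint C L)
    (hsp : V a ∉ spanOf V C) {f : MvPolynomial (Fin n) ℂ}
    (hf : f ∈ minorSpan V s 𝔹 (L.erase a) C) : linForm (V a) * f ∈ minorSpan V s 𝔹 L C := by
  suffices minorSpan V s 𝔹 (L.erase a) C ≤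
    (minorSpan V s 𝔹 L C).comap (LinearMap.mulLeft ℂ (linForm (V a))) from this hf
  refine Submodule.span_le.2 ?_
  rintro f ⟨B, hB, h, rfl⟩
  have haB : a ∉ B := fun h' => Finset.disjoint_left.1 hd
    ((h a).2 ⟨h', Finset.notMem_erase a L⟩) ha.mem
  rw [below_erase_of_notMem haB] at h
  change linForm (V a) * _ ∈ minorSpan V s 𝔹 L C
  rw [← pProd_activeIn_of_mem ((isLeast_mem_activeIn hL ha h).2 ⟨haB, hsp⟩)]
  exact mem_minorSpan hB h

end Minor

/-- Induction on #L, removing the least element a. If a ∈ Span C, no basis containing C contains a,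
and a is deleted. Otherwise the deletion of a handles all multiples of p_a, and the contraction of a
handles everything modulo such multiples. The case C = ∅, L = X' is the one needed later. -/
theorem le_sup_minor (s : E → E → Prop) [IsStrictTotalOrder E s] (L : Finset E)
    (hL : IsUpper s L) (C : Finset E) (hC : IsIndep V C) (hd : Disjoint C L) :
    minorSpan V s {B | IsBasis V B} L C ⊔ (minorIdeal V L C).restrictScalars ℂ = ⊤ := by
  induction hm : L.card generalizing L C with
  | zero =>
    obtain rfl := Finset.card_eq_zero.1 hm
    rw [eq_top_iff]
    intro f _
    -- With L empty only B = C is possible. If C is a basis, its linear forms leave only constants;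
    -- if not, the condition on Z is vacuous, so Z = ∅ puts 1 into the ideal.
    by_cases hB : IsBasis V C
    · have h1 : (1 : MvPolynomial (Fin n) ℂ) ∈ minorSpan V s {B | IsBasis V B} ∅ C := by
        simpa [activeIn, pProd] using
          mem_minorSpan (s := s) (𝔹 := {B | IsBasis V B}) (L := ∅) hB (fun e => by simp : ∀ e, e ∈ C ↔ e ∈ C ∧ e ∉ ∅)
      have h2 := sub_C_mem_ideal hB.spanOf_eq_top
        (fun c hc => linForm_mem_minorIdeal (L := ∅) hc) f
      refine Submodule.mem_sup.2 ⟨_, Submodule.smul_mem _ (constantCoeff f) h1, _, h2, ?_⟩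
      rw [smul_eq_C_mul]
      ring
    · have h1 : (1 : MvPolynomial (Fin n) ℂ) ∈ minorIdeal V ∅ C := by
        refine pProd_mem_minorIdeal (Finset.Subset.refl ∅) fun B hB' h => absurd ?_ hB
        have : C = B := by
          ext e
          simpa using h e
        exact this ▸ hB'
      rw [(Ideal.eq_top_iff_one _).2 h1]
      exact Submodule.mem_sup_right trivial
  | succ m ih =>
    obtain ⟨a, ha⟩ := exists_isLeast' s (Finset.card_pos.1 (by omega : 0 < L.card))
    have hm' : (L.erase a).card = m := by
      rw [Finset.card_erase_of_mem ha.mem, hm, Nat.add_sub_cancel]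
    have hU := hL.erase ha
    have hd' : Disjoint C (L.erase a) := hd.mono_right (Finset.erase_subset a L)
    have haC : a ∉ C := fun h => Finset.disjoint_left.1 hd h ha.mem
    have ih1 := ih (L.erase a) hU C hC hd' hm'
    by_cases hsp : V a ∈ spanOf V C
    · rw [eq_top_iff, ← ih1]
      refine sup_le_sup (minorSpan_erase_le_of_mem_spanOf (fun B hB => hB) hL ha hd hsp)
        (Ideal.span_le.2 ?_)
      rintro f (⟨c, hc, rfl⟩ | ⟨Z, hZ, hZB, rfl⟩)
      · exact linForm_mem_minorIdeal hc
      · refine pProd_mem_minorIdeal (hZ.trans (Finset.erase_subset a L)) fun B hB h =>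
          hZB B hB ((below_erase_of_notMem fun haB => ?_).2 h)
        exact hB.indep.notMem_spanOf haB (fun e he => ((h e).1 he).1) haC hsp
    · have hd1 : Disjoint (insert a C) (L.erase a) :=
        Finset.disjoint_insert_left.2 ⟨Finset.notMem_erase a L, hd'⟩
      have ih2 := ih (L.erase a) hU (insert a C) (hC.insert hsp) hd1 hm'
      -- Deletion: multiplication by p_a turns Z into Z ∪ a, which also meets the bases through a.
      have mul_mem : ∀ g, linForm (V a) * g ∈
          minorSpan V s {B | IsBasis V B} L C ⊔ (minorIdeal V L C).restrictScalars ℂ := by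
        intro g
        obtain ⟨p, hp, j, hj, rfl⟩ := Submodule.mem_sup.1 (ih1.ge (Submodule.mem_top (x := g)))
        rw [mul_add]
        refine add_mem (Submodule.mem_sup_left ?_) (Submodule.mem_sup_right ?_)
        · exact linForm_mul_mem_minorSpan hL ha hd hsp hp
        · suffices minorIdeal V (L.erase a) C ≤
              Submodule.comap (LinearMap.mulLeft (MvPolynomial (Fin n) ℂ)
                (linForm (V a))) (minorIdeal V L C) from this hj
          refine Submodule.span_le.2 ?_
          rintro f (⟨c, hc, rfl⟩ | ⟨Z, hZ, hZB, rfl⟩)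
          · exact Ideal.mul_mem_left _ _ (linForm_mem_minorIdeal hc)
          · have haZ : a ∉ Z := fun h => Finset.notMem_erase a L (hZ h)
            have : linForm (V a) * pProd V Z = pProd V (insert a Z) := by
              rw [pProd, pProd, Finset.prod_insert haZ]
            change linForm (V a) * _ ∈ minorIdeal V L C
            rw [this]
            refine pProd_mem_minorIdeal (Finset.insert_subset ha.mem
              (hZ.trans (Finset.erase_subset a L))) fun B hB h => ?_
            by_cases haB : a ∈ B
            · exact ⟨a, Finset.mem_insert_self a Z, haB⟩
            · obtain ⟨z, hz, hzB⟩ := hZB B hB ((below_erase_of_notMem haB).2 h)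
              exact ⟨z, Finset.mem_insert_of_mem hz, hzB⟩
      rw [eq_top_iff, ← ih2]
      refine sup_le ((minorSpan_erase_insert_le hL ha hd).trans le_sup_left) ?_
      · have : minorIdeal V (L.erase a) (insert a C) ≤
            Ideal.span {linForm (V a)} ⊔ minorIdeal V L C := by
          refine Ideal.span_le.2 ?_
          rintro f (⟨c, hc, rfl⟩ | ⟨Z, hZ, hZB, rfl⟩)
          · rcases Finset.mem_insert.1 hc with rfl | hc
            · exact Ideal.mem_sup_left (Ideal.mem_span_singleton_self _)
            · exact Ideal.mem_sup_right (linForm_mem_minorIdeal hc)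
          · refine Ideal.mem_sup_right (pProd_mem_minorIdeal (hZ.trans (Finset.erase_subset a L))
              fun B hB h => ?_)
            have hCB : C ⊆ B := fun e he => ((h e).1 he).1
            -- Basis exchange: a is forced into B at the cost of an element of L. Since a ∉ Z, a
            -- point of Z in B' is already in B.
            obtain ⟨B', h1, h2, hB'⟩ := (hC.insert hsp).exists_isBasis
              (Finset.insert_subset_insert a hCB)
              (top_le_iff.1 (hB.spanOf_eq_top.ge.trans (spanOf_mono (Finset.subset_insert a B))))
            have hCB' : ∀ e, e ∈ insert a C ↔ e ∈ B' ∧ e ∉ L.erase a := by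
              refine fun e => ⟨fun he => ⟨h1 he, Finset.disjoint_left.1 hd1 he⟩, fun ⟨he, heL⟩ => ?_⟩
              by_cases hea : e = a
              · exact hea ▸ Finset.mem_insert_self _ _
              · exact Finset.mem_insert_of_mem
                  ((h e).2 ⟨(Finset.mem_insert.1 (h2 he)).resolve_left hea,
                    fun heL' => heL (Finset.mem_erase.2 ⟨hea, heL'⟩)⟩)
            obtain ⟨z, hz, hzB⟩ := hZB B' hB' hCB'
            have hza : z ≠ a := fun h => Finset.notMem_erase a L (h ▸ hZ hz)
            exact ⟨z, hz, (Finset.mem_insert.1 (h2 hzB)).resolve_left hza⟩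
        intro f hf
        obtain ⟨g, hg, j, hj, rfl⟩ := Submodule.mem_sup.1 (this hf)
        obtain ⟨g, rfl⟩ := Ideal.mem_span_singleton.1 hg
        exact add_mem (mul_mem g) (Submodule.mem_sup_right hj)

end Central

/-! ### The basis set 𝔹_k and spanning modulo J_k -/

section Joint

variable {ι : Type*} {n M : ℕ} {x : ι → Fin n → ℝ} {y : Fin M → Fin n → ℝ} {k : Finset ι → ℕ}

theorem pProd_joint (S : Finset (ι ⊕ Fin M)) :
    pProd (joint x y) S = pProd x S.toLeft * pProd y S.toRight := by
  conv_lhs => rw [← Finset.toLeft_disjSum_toRight (u := S)]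
  simp [pProd, Finset.prod_disjSum]

theorem IsIndep.toLeft {B : Finset (ι ⊕ Fin M)} (h : IsIndep (joint x y) B) :
    IsIndep x B.toLeft :=
  LinearIndependent.comp h (fun z : {z // z ∈ B.toLeft} => ⟨Sum.inl z, Finset.mem_toLeft.1 z.2⟩)
    fun a b hab => by
      ext
      simpa using congrArg Subtype.val hab

theorem IsBasis.card_toLeft_add {B : Finset (ι ⊕ Fin M)} (h : IsBasis (joint x y) B) :
    B.toLeft.card + B.toRight.card = n := by
  rw [Finset.card_toLeft_add_card_toRight, h.card_eq]

theorem card_filter_lt_extNum {I : Finset ι} (hM : LongEnough x k M) (hI : IsIndep x I) :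
    (Finset.univ.filter fun j : Fin M => (j : ℕ) < extNum n k I).card = extNum n k I := by
  rw [Fin.card_filter_val_lt]
  exact min_eq_right (hM I hI)

/-- This explains the value of m(I): since #I + #J = n, exactly k(I) vectors of Y_{m(I)} remain
outside B. -/
theorem card_filter_sdiff_toRight {B : Finset (ι ⊕ Fin M)} (hM : LongEnough x k M)
    (hB : B ∈ basisSet x y k) :
    ((Finset.univ.filter fun j : Fin M => (j : ℕ) < extNum n k B.toLeft) \ B.toRight).card =
      k B.toLeft := by
  rw [Finset.card_sdiff_of_subset fun j hj => Finset.mem_filter.2 ⟨Finset.mem_univ j, hB.2 j hj⟩,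
    card_filter_lt_extNum hM hB.1.indep.toLeft, extNum]
  have := hB.1.card_toLeft_add
  omega

theorem Solid.mono (hk : Solid x k) {Z Z' : Finset ι} (h : Z ⊆ Z') : k Z ≤ k Z' :=
  hk Z Z' (spanOf_mono h)

theorem card_filter_fin_le (a b : ℕ) :
    (Finset.univ.filter fun j : Fin M => a ≤ (j : ℕ) ∧ (j : ℕ) < b).card ≤ b - a := by
  rw [← Nat.card_Ico, ← Finset.card_map Fin.valEmbedding]
  refine Finset.card_le_card fun i hi => ?_
  obtain ⟨i, hi', rfl⟩ := Finset.mem_map.1 hi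
  exact Finset.mem_Ico.2 (Finset.mem_filter.1 hi').2

variable [Fintype ι]

theorem activeSet_eq (r : ι → ι → Prop) (B : Finset (ι ⊕ Fin M)) :
    activeSet x y r B = activeIn (joint x y) (Sum.Lex r (· < ·)) Finset.univ B := by
  unfold activeSet activeIn
  congr!

theorem mem_activeSet {r : ι → ι → Prop} {B : Finset (ι ⊕ Fin M)} {z : ι ⊕ Fin M} :
    z ∈ activeSet x y r B ↔ z ∉ B ∧ ∃ C : Finset (ι ⊕ Fin M),
      (∀ b, b ∈ C ↔ b ∈ B ∧ Sum.Lex r (· < ·) b z) ∧ joint x y z ∉ spanOf (joint x y) C := by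
  rw [activeSet_eq, mem_activeIn, and_iff_right (Finset.mem_univ z)]

/-- A vector of Y beyond Y_{m(I)} comes after all of B, so it is in the span of its predecessors in
B and cannot be active. -/
theorem activeSet_toRight_subset {r : ι → ι → Prop} {B : Finset (ι ⊕ Fin M)}
    (hB : B ∈ basisSet x y k) : (activeSet x y r B).toRight ⊆
      (Finset.univ.filter fun j : Fin M => (j : ℕ) < extNum n k B.toLeft) \ B.toRight := by
  intro j hj
  rw [Finset.mem_toRight, mem_activeSet] at hj
  obtain ⟨hjB, C, hC, hj⟩ := hj
  rw [Finset.mem_sdiff, Finset.mem_filter, Finset.mem_toRight]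
  refine ⟨⟨Finset.mem_univ j, ?_⟩, hjB⟩
  by_contra hlt
  have : C = B := by
    ext b
    rw [hC, and_iff_left_iff_imp]
    intro hb
    rcases b with b | b
    · exact Sum.Lex.sep _ _
    · exact Sum.Lex.inr (Fin.lt_def.2 ((hB.2 b (Finset.mem_toRight.2 hb)).trans_le (not_lt.1 hlt)))
  rw [this, hB.1.spanOf_eq_top] at hj
  exact hj Submodule.mem_top

/-- If `B` is not in `𝔹_k`, then its active set meets every member of `𝔹_k`. -/
theorem exists_mem_activeSet (hk : Solid x k) (hy : GeneralPosition x y) {r : ι → ι → Prop}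
    {B B' : Finset (ι ⊕ Fin M)} (hB : IsBasis (joint x y) B) (hBk : B ∉ basisSet x y k)
    (hB' : B' ∈ basisSet x y k) : ∃ z ∈ activeSet x y r B, z ∈ B' := by
  classical
  by_contra! hcon
  have hspan : ∀ b ∈ B', b ∈ B ∨
      joint x y b ∈ spanOf (joint x y) (B.filter fun c => Sum.Lex r (· < ·) c b) := by
    intro b hb
    by_contra! h
    exact hcon b (mem_activeSet.2 ⟨h.1, _, fun c => Finset.mem_filter, h.2⟩) hb
  -- Only vectors of X precede a vector of X, so B' ∩ X is spanned by B ∩ X; solidity then compares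
  -- the values of k.
  have hI : spanOf x B'.toLeft ≤ spanOf x B.toLeft := by
    rw [spanOf_le]
    intro b hb
    rcases hspan _ (Finset.mem_toLeft.1 hb) with h | h
    · exact mem_spanOf (Finset.mem_toLeft.2 h)
    · refine (spanOf_le.2 ?_ : _ ≤ spanOf x B.toLeft) h
      intro c hc
      rw [Finset.mem_filter] at hc
      obtain ⟨hcB, hlt⟩ := hc
      cases hlt with
      | inl _ => exact mem_spanOf (Finset.mem_toLeft.2 hcB)
  have hcard := hB'.1.indep.toLeft.card_le_of_spanOf_le hI
  have hkk := hk _ _ hI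
  obtain ⟨j, hjB, hj⟩ : ∃ j ∈ B.toRight, extNum n k B.toLeft ≤ (j : ℕ) := by
    by_contra! h
    exact hBk ⟨hB, h⟩
  -- By general position, y_i with i ∉ B is spanned by its predecessors in B only if these are all
  -- of B. Then i comes after the offending j ≥ m(B ∩ X), which makes the lower bound on i strict;
  -- this one unit decides the count below.
  have hsub : B'.toRight ⊆ B.toRight ∪ (Finset.univ.filter fun i : Fin M =>
      extNum n k B.toLeft < (i : ℕ) ∧ (i : ℕ) < extNum n k B'.toLeft) := by
    intro i hi
    rw [Finset.mem_union]
    rcases hspan _ (Finset.mem_toRight.1 hi) with h | h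
    · exact Or.inl (Finset.mem_toRight.2 h)
    · right
      have hc : ¬ (B.filter fun c => Sum.Lex r (· < ·) c (Sum.inr i)).card < n := by
        intro hc
        refine hy i _ ?_ hc h
        rw [Finset.mem_filter]
        rintro ⟨-, hlt⟩
        cases hlt with
        | inr h => exact lt_irrefl _ h
      have heq := Finset.eq_of_subset_of_card_le (Finset.filter_subset _ B)
        (by rw [hB.card_eq]; exact not_lt.1 hc)
      have hj' : Sum.inr j ∈ B := Finset.mem_toRight.1 hjB
      rw [← heq, Finset.mem_filter] at hj'
      obtain ⟨-, hlt⟩ := hj'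
      cases hlt with
      | inr h =>
        exact Finset.mem_filter.2 ⟨Finset.mem_univ i, hj.trans_lt (Fin.lt_def.1 h), hB'.2 i hi⟩
  have hint : (Finset.univ.filter fun i : Fin M =>
      extNum n k B.toLeft < (i : ℕ) ∧ (i : ℕ) < extNum n k B'.toLeft).card ≤
        extNum n k B'.toLeft - (extNum n k B.toLeft + 1) :=
    card_filter_fin_le _ _
  have h1 := hB.card_toLeft_add
  have h2 := hB'.1.card_toLeft_add
  have h3 := (Finset.card_le_card hsub).trans (Finset.card_union_le _ _)
  -- The split avoids truncated subtraction. With an empty interval, B' ∩ Y = B ∩ Y contains j,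
  -- against j ≥ m(B ∩ X) ≥ m(B' ∩ X). Otherwise #(B' ∩ Y) would be less than n - #(B' ∩ X).
  by_cases hm : extNum n k B'.toLeft ≤ extNum n k B.toLeft + 1
  · have hsub' : B'.toRight ⊆ B.toRight := by
      intro i hi
      refine (Finset.mem_union.1 (hsub hi)).resolve_right fun h => ?_
      have := (Finset.mem_filter.1 h).2
      omega
    have h4 := Finset.card_le_card hsub'
    have h5 := Finset.eq_of_subset_of_card_le hsub' (by omega)
    have h6 := hB'.2 j (h5 ▸ hjB)
    simp only [extNum] at *
    omega
  · simp only [extNum] at *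
    omega

theorem pSpan_sup_jIdeal (hk : Solid x k) (hy : GeneralPosition x y) (r : ι → ι → Prop)
    [IsStrictTotalOrder ι r] :
    Submodule.span ℂ (Set.range fun B : {B // B ∈ basisSet x y k} =>
      pProd (joint x y) (activeSet x y r B)) ⊔ (jIdeal x y k).restrictScalars ℂ = ⊤ := by
  classical
  have : IsStrictTotalOrder (ι ⊕ Fin M) (Sum.Lex r (· < ·)) := { }
  rw [eq_top_iff, ← le_sup_minor (V := joint x y) (Sum.Lex r (· < ·)) Finset.univ
    (fun e he => absurd (Finset.mem_univ e) he) ∅ isIndep_empty (Finset.disjoint_empty_left _)]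
  refine sup_le (Submodule.span_le.2 ?_) (le_sup_of_le_right ?_)
  · rintro f ⟨B, hB, -, rfl⟩
    by_cases hBk : B ∈ basisSet x y k
    · exact Submodule.mem_sup_left (Submodule.subset_span ⟨⟨B, hBk⟩, congrArg _ (activeSet_eq r B)⟩)
    · rw [← activeSet_eq]
      exact Submodule.mem_sup_right (Ideal.subset_span
        ⟨_, fun B' hB' => exists_mem_activeSet hk hy hB hBk hB', rfl⟩)
  · suffices minorIdeal (joint x y) Finset.univ ∅ ≤ jIdeal x y k from this
    refine Ideal.span_le.2 ?_
    rintro f (⟨c, hc, rfl⟩ | ⟨Z, -, hZ, rfl⟩)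
    · simp at hc
    · exact Ideal.subset_span ⟨Z, fun B hB => hZ B hB.1 (by simp), rfl⟩

variable [DecidableEq ι]

theorem pProd_mul_mem_pSpace {Z : Finset ι} {g : MvPolynomial (Fin n) ℂ}
    (hg : g.totalDegree ≤ k Z) : pProd x (Finset.univ \ Z) * g ∈ pSpace x k :=
  Submodule.mem_iSup_of_mem (p := fun Z : Finset ι => (restrictTotalDegree (Fin n) ℂ (k Z)).map
    (LinearMap.mulLeft ℂ (pProd x (Finset.univ \ Z)))) Z
    ⟨g, (mem_restrictTotalDegree _ _ _).2 hg, rfl⟩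

/-- Take Z to be the set of inactive vectors of X. It contains I = B ∩ X, so k(I) ≤ k(Z), and the
active vectors of Y contribute degree at most k(I). -/
theorem pProd_activeSet_mem_pSpace (hk : Solid x k) (hM : LongEnough x k M) {r : ι → ι → Prop}
    {B : Finset (ι ⊕ Fin M)} (hB : B ∈ basisSet x y k) :
    pProd (joint x y) (activeSet x y r B) ∈ pSpace x k := by
  set A := activeSet x y r B with hA
  rw [pProd_joint, ← Finset.sdiff_sdiff_eq_self (Finset.subset_univ A.toLeft)]
  apply pProd_mul_mem_pSpace
  calc _ ≤ A.toRight.card := (isHomogeneous_pProd y _).totalDegree_le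
    _ ≤ _ := Finset.card_le_card (activeSet_toRight_subset hB)
    _ = k B.toLeft := card_filter_sdiff_toRight hM hB
    _ ≤ _ := hk.mono fun z hz => by
      rw [Finset.mem_sdiff]
      refine ⟨Finset.mem_univ z, fun h => ?_⟩
      rw [Finset.mem_toLeft, hA, mem_activeSet] at h
      exact h.1 (Finset.mem_toLeft.1 hz)

end Joint

/-! ### Perturbing homogeneous spanning sets -/

section Leading

variable {n : ℕ}

/-- The polynomials of degree less than `d`. -/
noncomputable def lowDeg (n d : ℕ) : Submodule ℂ (MvPolynomial (Fin n) ℂ) :=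
  restrictSupport ℂ {m | m.degree < d}

theorem mem_lowDeg {d : ℕ} {f : MvPolynomial (Fin n) ℂ} :
    f ∈ lowDeg n d ↔ ∀ m, coeff m f ≠ 0 → m.degree < d := by
  rw [lowDeg, mem_restrictSupport_iff]
  simp [Set.subset_def]

/-- The shift by one in the second factor says degree at most b, so that a strict bound times a weak
bound is strict. -/
theorem mul_mem_lowDeg {a b : ℕ} {f g : MvPolynomial (Fin n) ℂ} (hf : f ∈ lowDeg n a)
    (hg : g ∈ lowDeg n (b + 1)) : f * g ∈ lowDeg n (a + b) := by
  classical
  rw [mem_lowDeg] at *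
  intro m hm
  obtain ⟨u, hu, v, hv, rfl⟩ := Finset.mem_add.1 (support_mul f g (mem_support_iff.2 hm))
  have h1 := hf u (mem_support_iff.1 hu)
  have h2 := hg v (mem_support_iff.1 hv)
  rw [map_add]
  omega

theorem IsHomogeneous.mem_lowDeg {d : ℕ} {f : MvPolynomial (Fin n) ℂ}
    (hf : MvPolynomial.IsHomogeneous f d) : f ∈ lowDeg n (d + 1) := by
  rw [Zonotopal.mem_lowDeg]
  intro m hm
  by_contra h
  exact hm (hf.coeff_eq_zero (by omega))

theorem mem_lowDeg_totalDegree (f : MvPolynomial (Fin n) ℂ) :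
    f ∈ lowDeg n (f.totalDegree + 1) := by
  rw [mem_lowDeg]
  intro m hm
  have := le_totalDegree (mem_support_iff.2 hm)
  exact Nat.lt_succ_of_le this

theorem qProd_sub_pProd_mem_lowDeg {E : Type*} (V : E → Fin n → ℝ) (c : E → ℝ) (Z : Finset E) :
    qProd V c Z - pProd V Z ∈ lowDeg n Z.card := by
  classical
  induction Z using Finset.induction_on with
  | empty => simp [qProd, pProd]
  | insert a Z ha ih =>
    have hC : (C (c a : ℂ) : MvPolynomial (Fin n) ℂ) ∈ lowDeg n (0 + 1) :=
      IsHomogeneous.mem_lowDeg (isHomogeneous_C _ _)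
    have hp : pProd V Z ∈ lowDeg n (Z.card + 1) :=
      IsHomogeneous.mem_lowDeg (isHomogeneous_pProd V Z)
    have hl : linForm (V a) ∈ lowDeg n (1 + 1) :=
      IsHomogeneous.mem_lowDeg (isHomogeneous_linForm (V a))
    have hmono : lowDeg n Z.card ≤ lowDeg n (Z.card + 1) := fun f hf =>
      mem_lowDeg.2 fun m hm => (mem_lowDeg.1 hf m hm).trans (Nat.lt_succ_self _)
    have hq : qProd V c Z ∈ lowDeg n (Z.card + 1) := by
      simpa using add_mem (hmono ih) hp
    rw [Finset.card_insert_of_notMem ha]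
    have h1 := mul_mem_lowDeg ih hl
    have h2 := mul_mem_lowDeg hC hq
    have : qProd V c (insert a Z) - pProd V (insert a Z) =
        (qProd V c Z - pProd V Z) * linForm (V a) - C (c a : ℂ) * qProd V c Z := by
      rw [qProd, pProd, Finset.prod_insert ha, Finset.prod_insert ha, affForm, qProd, pProd]
      ring
    rw [this]
    refine sub_mem h1 ?_
    convert h2 using 2
    ring

/-- If homogeneous polynomials span, so do polynomials with these leading forms. -/
theorem span_eq_top_of_leading {κ : Type*} (s r : κ → MvPolynomial (Fin n) ℂ) (d : κ → ℕ)
    (hs : ∀ i, (s i).IsHomogeneous (d i)) (hr : ∀ i, r i - s i ∈ lowDeg n (d i))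
    (h : Submodule.span ℂ (Set.range s) = ⊤) : Submodule.span ℂ (Set.range r) = ⊤ := by
  set W := Submodule.span ℂ (Set.range r) with hW
  -- The degree-e component of any s_i is s_i itself or 0, so components of degree e come from the
  -- r_i up to lower degree. Induction on the degree then absorbs the error.
  have key : ∀ e, ∀ f : MvPolynomial (Fin n) ℂ, homogeneousComponent e f ∈ W ⊔ lowDeg n e := by
    intro e f
    suffices (⊤ : Submodule ℂ (MvPolynomial (Fin n) ℂ)) ≤
      (W ⊔ lowDeg n e).comap (homogeneousComponent e) from this Submodule.mem_top
    rw [← h, Submodule.span_le]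
    rintro _ ⟨i, rfl⟩
    change homogeneousComponent e (s i) ∈ W ⊔ lowDeg n e
    rw [homogeneousComponent_of_mem (hs i)]
    split_ifs with hi
    · subst hi
      have := sub_mem (Submodule.mem_sup_left (Submodule.subset_span (Set.mem_range_self i)) :
        r i ∈ W ⊔ lowDeg n (d i)) (Submodule.mem_sup_right (hr i))
      simpa using this
    · exact zero_mem _
  have low : ∀ e, lowDeg n e ≤ W := by
    intro e
    induction e with
    | zero =>
      intro f hf
      have : f = 0 := by
        ext m
        by_contra hm
        exact Nat.not_lt_zero _ (mem_lowDeg.1 hf m hm)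
      rw [this]
      exact zero_mem W
    | succ e ih =>
      intro f hf
      have h1 : f - homogeneousComponent e f ∈ lowDeg n e := by
        rw [mem_lowDeg] at hf ⊢
        intro m hm
        rw [coeff_sub, coeff_homogeneousComponent] at hm
        split_ifs at hm with h
        · simp at hm
        · have := hf m (by simpa using hm)
          omega
      have h2 := (sup_le le_rfl ih : W ⊔ lowDeg n e ≤ W) (key e f)
      simpa using add_mem (ih h1) h2
  exact eq_top_iff.2 fun f _ => low _ (mem_lowDeg_totalDegree f)

end Leading

/-! ### Generic constants and evaluation at vertices -/

section Generic

variable {E : Type*} {n : ℕ} {V : E → Fin n → ℝ}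

/-- For each S with n + 1 elements, the constants for which the q_z, z ∈ S, have a common zero form
a proper subspace, since the values at S come from an n-dimensional space. Finitely many proper
subspaces do not cover a real vector space. -/
theorem exists_generic [Finite E] (V : E → Fin n → ℝ) : ∃ c : E → ℝ, Generic V c := by
  classical
  have := Fintype.ofFinite E
  let A (S : Finset E) : Matrix {z // z ∈ S} (Fin n) ℝ := Matrix.of fun z => V z
  let T (S : Finset E) : Submodule ℝ (E → ℝ) :=
    (LinearMap.range (A S).mulVecLin).comap (LinearMap.funLeft ℝ ℝ Subtype.val)
  have hT : ⊤ ∉ (Finset.univ.filter fun S : Finset E => S.card = n + 1).image T := by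
    intro h
    obtain ⟨S, hS, htop⟩ := Finset.mem_image.1 h
    have hsurj := LinearMap.funLeft_surjective_of_injective ℝ ℝ
      (Subtype.val : {z // z ∈ S} → E) Subtype.val_injective
    have hr : LinearMap.range (A S).mulVecLin = ⊤ := by
      rw [eq_top_iff]
      intro w _
      obtain ⟨c, rfl⟩ := hsurj w
      exact htop.ge (Submodule.mem_top (x := c))
    have := LinearMap.finrank_range_le (A S).mulVecLin
    rw [hr, finrank_top, Module.finrank_fintype_fun_eq_card, Module.finrank_fintype_fun_eq_card,
      Fintype.card_coe, Fintype.card_fin, (Finset.mem_filter.1 hS).2] at this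
    omega
  obtain ⟨c, hc⟩ := (Set.ne_univ_iff_exists_notMem _).1 (Subspace.biUnion_ne_univ_of_top_notMem hT)
  refine ⟨c, fun S hS => ?_⟩
  rintro ⟨v, hv⟩
  refine hc (Set.mem_biUnion (Finset.mem_image_of_mem T
    (Finset.mem_filter.2 ⟨Finset.mem_univ S, hS⟩)) ⟨v, ?_⟩)
  funext z
  have := hv z z.2
  rw [evalAt_affForm, Complex.ofReal_eq_zero, sub_eq_zero] at this
  exact this

theorem Generic.evalAt_vertex_ne_zero {c : E → ℝ} (hc : Generic V c) {B : Finset E}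
    (hB : IsBasis V B) {z : E} (hz : z ∉ B) : evalAt (hB.vertex c) (affForm V c z) ≠ 0 := by
  classical
  intro h
  refine hc (insert z B) (by rw [Finset.card_insert_of_notMem hz, hB.card_eq]) ⟨hB.vertex c, ?_⟩
  intro w hw
  rcases Finset.mem_insert.1 hw with rfl | hw
  · exact h
  · exact (hB.eq_vertex_iff c _).1 rfl w hw

theorem evalAt_vertex {c : E → ℝ} {B : Finset E} (hB : IsBasis V B) {z : E} (hz : z ∈ B) :
    evalAt (hB.vertex c) (affForm V c z) = 0 :=
  (hB.eq_vertex_iff c _).1 rfl z hz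

theorem evalAt_mul (v : Fin n → ℝ) (f g : MvPolynomial (Fin n) ℂ) :
    evalAt v (f * g) = evalAt v f * evalAt v g := map_mul _ _ _

theorem evalAt_qProd (v : Fin n → ℝ) (c : E → ℝ) (Z : Finset E) :
    evalAt v (qProd V c Z) = ∏ z ∈ Z, evalAt v (affForm V c z) := map_prod _ _ _

/-- Evaluation of polynomials at real points, as a linear map. -/
noncomputable def evalₗ {κ : Type*} (v : κ → Fin n → ℝ) : MvPolynomial (Fin n) ℂ →ₗ[ℂ] κ → ℂ :=
  LinearMap.pi fun i => (aeval fun j => (v i j : ℂ)).toLinearMap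

theorem evalₗ_apply {κ : Type*} (v : κ → Fin n → ℝ) (f : MvPolynomial (Fin n) ℂ) (i : κ) :
    evalₗ v f i = evalAt (v i) f := by
  exact DFunLike.congr_fun (coe_aeval_eq_eval fun j => (v i j : ℂ)) f

/-- Polynomials that are dual to points, up to nonzero factors, are independent at these points. -/
theorem linearIndependent_evalₗ {κ : Type*} [Fintype κ] {v : κ → Fin n → ℝ}
    {f : κ → MvPolynomial (Fin n) ℂ} (h : ∀ i j, evalAt (v j) (f i) = 0 ↔ j ≠ i) :
    LinearIndependent ℂ fun i => evalₗ v (f i) := by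
  rw [Fintype.linearIndependent_iff]
  intro g hg i
  have h1 := congrFun hg i
  simp only [Finset.sum_apply, Pi.smul_apply, evalₗ_apply, smul_eq_mul, Pi.zero_apply] at h1
  rw [Finset.sum_eq_single i (fun j _ hj => by rw [(h j i).2 hj.symm, mul_zero])
    (fun hi => absurd (Finset.mem_univ i) hi)] at h1
  exact (mul_eq_zero.1 h1).resolve_right fun h' => (h i i).1 h' rfl

theorem linearIndependent_of_evalAt {κ : Type*} [Fintype κ] {v : κ → Fin n → ℝ}
    {f : κ → MvPolynomial (Fin n) ℂ} (h : ∀ i j, evalAt (v j) (f i) = 0 ↔ j ≠ i) :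
    LinearIndependent ℂ f :=
  LinearIndependent.of_comp (evalₗ v) (linearIndependent_evalₗ h)

/-- Evaluation at the vertices of a set of bases is surjective, for generic constants. -/
theorem map_evalₗ_top [Fintype E] {c : E → ℝ} (hc : Generic V c) (S : Set (Finset E))
    (hS : ∀ B ∈ S, IsBasis V B) :
    (⊤ : Submodule ℂ (MvPolynomial (Fin n) ℂ)).map
      (evalₗ fun B : {B // B ∈ S} => (hS B B.2).vertex c) = ⊤ := by
  classical
  -- The product of all q_z with z ∉ B vanishes at b(B') exactly for B' ≠ B: bases have equal size,
  -- so another B' has an element outside B.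
  have h := linearIndependent_evalₗ (v := fun B : {B // B ∈ S} => (hS B B.2).vertex c)
    (f := fun B => qProd V c (Finset.univ \ B)) fun B B' => by
      rw [evalAt_qProd, Finset.prod_eq_zero_iff]
      constructor
      · rintro ⟨z, hz, h0⟩ rfl
        exact hc.evalAt_vertex_ne_zero (hS _ B'.2) (Finset.mem_sdiff.1 hz).2 h0
      · intro hne
        obtain ⟨z, hz, hzB⟩ : ∃ z ∈ (B' : Finset E), z ∉ (B : Finset E) := by
          by_contra! hsub
          refine hne (Subtype.ext (Finset.eq_of_subset_of_card_le hsub ?_))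
          rw [(hS _ B.2).card_eq, (hS _ B'.2).card_eq]
        exact ⟨z, Finset.mem_sdiff.2 ⟨Finset.mem_univ z, hzB⟩, evalAt_vertex (hS _ B'.2) hz⟩
  rw [eq_top_iff, ← h.span_eq_top_of_card_eq_finrank' (by simp), Submodule.span_le]
  rintro _ ⟨B, rfl⟩
  exact ⟨_, trivial, rfl⟩

end Generic

/-! ### The codimension of J_k is at least #𝔹_k -/

section JIdeal

variable {ι : Type*} {n M : ℕ} {x : ι → Fin n → ℝ} {y : Fin M → Fin n → ℝ} {k : Finset ι → ℕ}

/-- The sets meeting every member of `𝔹_k`. -/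
def Meets (x : ι → Fin n → ℝ) (y : Fin M → Fin n → ℝ) (k : Finset ι → ℕ)
    (Z : Finset (ι ⊕ Fin M)) : Prop := ∀ B ∈ basisSet x y k, ∃ z ∈ Z, z ∈ B

/-- Homogeneous linear generators of J_k: they can be perturbed one by one, and they show that J_k
is a graded ideal. -/
theorem jIdeal_eq_span : (jIdeal x y k).restrictScalars ℂ = Submodule.span ℂ (Set.range
    fun u : (Fin n →₀ ℕ) × {Z // Meets x y k Z} =>
      monomial u.1 (1 : ℂ) * pProd (joint x y) u.2) := by
  have h : Submodule.span ℂ (Set.range fun m : Fin n →₀ ℕ => (monomial m (1 : ℂ))) = ⊤ := by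
    simpa using (basisMonomials (Fin n) ℂ).span_eq
  rw [jIdeal, Ideal.span, ← Submodule.span_smul_of_span_eq_top h]
  congr 1
  ext f
  constructor
  · rintro ⟨_, ⟨m, rfl⟩, _, ⟨Z, hZ, rfl⟩, rfl⟩
    exact ⟨(m, ⟨Z, hZ⟩), rfl⟩
  · rintro ⟨⟨m, Z⟩, rfl⟩
    exact ⟨_, ⟨m, rfl⟩, _, ⟨Z, Z.2, rfl⟩, rfl⟩

theorem isHomogeneous_monomial_mul_pProd {E : Type*} (V : E → Fin n → ℝ) (m : Fin n →₀ ℕ)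
    (Z : Finset E) :
    (monomial m (1 : ℂ) * pProd V Z).IsHomogeneous (m.degree + Z.card) :=
  (isHomogeneous_monomial _ rfl).mul (isHomogeneous_pProd V Z)

/-- Homogeneous polynomials that span modulo `J_k` are at least as many as the members of
`𝔹_k`. -/
theorem card_le_of_span_sup_jIdeal [Finite ι] {κ : Type*} [Fintype κ]
    (f : κ → MvPolynomial (Fin n) ℂ) (d : κ → ℕ) (hf : ∀ i, (f i).IsHomogeneous (d i))
    (h : Submodule.span ℂ (Set.range f) ⊔ (jIdeal x y k).restrictScalars ℂ = ⊤) :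
    Nat.card {B // B ∈ basisSet x y k} ≤ Fintype.card κ := by
  classical
  have := Fintype.ofFinite ι
  obtain ⟨c, hc⟩ := exists_generic (joint x y)
  -- Replace p_Z by q_Z in the generators of J_k and leave the f_i alone; the leading forms are
  -- unchanged, so the result still spans Π.
  have hsp := span_eq_top_of_leading (Sum.elim f fun u : (Fin n →₀ ℕ) × {Z // Meets x y k Z} =>
      monomial u.1 (1 : ℂ) * pProd (joint x y) u.2)
    (Sum.elim f fun u => monomial u.1 (1 : ℂ) * qProd (joint x y) c u.2)
    (Sum.elim d fun u => u.1.degree + u.2.1.card)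
    (by
      rintro (i | u)
      · exact hf i
      · exact isHomogeneous_monomial_mul_pProd _ _ _)
    (by
      rintro (i | u)
      · simp
      · simp only [Sum.elim_inr]
        rw [← mul_sub, mul_comm, add_comm]
        exact mul_mem_lowDeg (qProd_sub_pProd_mem_lowDeg _ c _)
          (IsHomogeneous.mem_lowDeg (isHomogeneous_monomial _ rfl)))
    (by rw [Set.Sum.elim_range, Submodule.span_union, ← jIdeal_eq_span, h])
  have hmap := map_evalₗ_top hc (basisSet x y k) fun B hB => hB.1
  -- Every Z in question meets every B ∈ 𝔹_k, so the perturbed generators vanish at all vertices.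
  -- The values of the f_i alone must span ℂ^{𝔹_k}.
  rw [← hsp, Set.Sum.elim_range, Submodule.span_union, Submodule.map_sup, sup_eq_left.2] at hmap
  · rw [Submodule.map_span, ← Set.range_comp] at hmap
    have := finrank_range_le_card (R := ℂ) ((evalₗ fun B : {B // B ∈ basisSet x y k} =>
      B.2.1.vertex c) ∘ f)
    rw [Set.finrank, hmap, finrank_top, Module.finrank_fintype_fun_eq_card] at this
    rwa [Nat.card_eq_fintype_card]
  · rw [Submodule.map_span, Submodule.span_le]
    rintro _ ⟨_, ⟨u, rfl⟩, rfl⟩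
    suffices (evalₗ fun B : {B // B ∈ basisSet x y k} => B.2.1.vertex c)
      (monomial u.1 (1 : ℂ) * qProd (joint x y) c u.2) = 0 by
      rw [this]
      exact zero_mem _
    funext B
    obtain ⟨z, hz, hzB⟩ := u.2.2 B B.2
    rw [evalₗ_apply, evalAt_mul, evalAt_qProd, Finset.prod_eq_zero hz (evalAt_vertex B.2.1 hzB),
      mul_zero]
    rfl

end JIdeal

/-! ### The homogeneous basis -/

section Homogeneous

variable {ι : Type*} [Fintype ι] {n M : ℕ} {x : ι → Fin n → ℝ} {y : Fin M → Fin n → ℝ}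
  {k : Finset ι → ℕ}

/-- The homogeneous family is linearly independent modulo `J_k`. -/
theorem linearIndependent_mkQ (hk : Solid x k) (hy : GeneralPosition x y) (r : ι → ι → Prop)
    [IsStrictTotalOrder ι r] :
    LinearIndependent ℂ (((jIdeal x y k).restrictScalars ℂ).mkQ ∘
      fun B : {B // B ∈ basisSet x y k} => pProd (joint x y) (activeSet x y r B)) := by
  classical
  rw [linearIndependent_iff_notMem_span]
  intro B₀ h₀
  set J := (jIdeal x y k).restrictScalars ℂ with hJ
  set p := fun B : {B // B ∈ basisSet x y k} => pProd (joint x y) (activeSet x y r B) with hp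
  -- A dependent member could be omitted, leaving a homogeneous spanning family modulo J_k with only
  -- #𝔹_k - 1 members.
  have hsp : Submodule.span ℂ (Set.range fun B : {B // B ≠ B₀} => p B) ⊔ J = ⊤ := by
    rw [eq_top_iff, ← pSpan_sup_jIdeal (k := k) hk hy r]
    refine sup_le (Submodule.span_le.2 ?_) le_sup_right
    rintro _ ⟨B, rfl⟩
    by_cases hB : B = B₀
    · subst hB
      rw [Set.image_comp, Submodule.span_image] at h₀
      obtain ⟨f, hf, hfe⟩ := h₀
      have hmem : p B - f ∈ J := by
        rw [← Submodule.ker_mkQ J, LinearMap.mem_ker, map_sub, hfe]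
        exact sub_self _
      have hf' : f ∈ Submodule.span ℂ (Set.range fun B' : {B' // B' ≠ B} => p B') := by
        refine Submodule.span_mono ?_ hf
        rintro _ ⟨B', hB', rfl⟩
        exact ⟨⟨B', hB'.2⟩, rfl⟩
      have := add_mem (Submodule.mem_sup_left hf') (Submodule.mem_sup_right hmem)
      rwa [add_sub_cancel] at this
    · exact Submodule.mem_sup_left (Submodule.subset_span ⟨⟨B, hB⟩, rfl⟩)
  have hcard := card_le_of_span_sup_jIdeal _ _ (fun B => isHomogeneous_pProd _ _) hsp
  rw [Nat.card_eq_fintype_card, Fintype.card_subtype_compl, Fintype.card_subtype_eq] at hcard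
  have : 0 < Fintype.card {B // B ∈ basisSet x y k} := Fintype.card_pos_iff.2 ⟨B₀⟩
  omega

theorem linearIndependent_activeSet (hk : Solid x k) (hy : GeneralPosition x y) (r : ι → ι → Prop)
    [IsStrictTotalOrder ι r] :
    LinearIndependent ℂ fun B : {B // B ∈ basisSet x y k} =>
      pProd (joint x y) (activeSet x y r B) :=
  LinearIndependent.of_comp _ (linearIndependent_mkQ hk hy r)

theorem finrank_span_activeSet (hk : Solid x k) (hy : GeneralPosition x y) (r : ι → ι → Prop)
    [IsStrictTotalOrder ι r] :
    Module.finrank ℂ (Submodule.span ℂ (Set.range fun B : {B // B ∈ basisSet x y k} =>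
      pProd (joint x y) (activeSet x y r B))) = (basisSet x y k).ncard := by
  classical
  rw [finrank_span_eq_card (linearIndependent_activeSet hk hy r), ← Nat.card_coe_set_eq,
    Nat.card_eq_fintype_card]

theorem isCompl_span_activeSet (hk : Solid x k) (hy : GeneralPosition x y) (r : ι → ι → Prop)
    [IsStrictTotalOrder ι r] :
    IsCompl (Submodule.span ℂ (Set.range fun B : {B // B ∈ basisSet x y k} =>
      pProd (joint x y) (activeSet x y r B))) ((jIdeal x y k).restrictScalars ℂ) := by
  refine ⟨?_, codisjoint_iff.2 (pSpan_sup_jIdeal hk hy r)⟩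
  have := Submodule.range_ker_disjoint (linearIndependent_mkQ hk hy r)
  rwa [Submodule.ker_mkQ] at this

variable [DecidableEq ι]

instance finiteDimensional_pSpace (x : ι → Fin n → ℝ) (k : Finset ι → ℕ) :
    FiniteDimensional ℂ (pSpace x k) := by
  have (Z : Finset ι) : FiniteDimensional ℂ (restrictTotalDegree (Fin n) ℂ (k Z)) := by
    have : Finite {d : Fin n →₀ ℕ | (d.sum fun _ e => e) ≤ k Z} :=
      Set.Finite.to_subtype (Finsupp.finite_of_degree_le (k Z))
    exact Module.Finite.of_basis (basisRestrictSupport ℂ _)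
  exact Submodule.finiteDimensional_iSup _

theorem span_activeSet_le (hk : Solid x k) (hM : LongEnough x k M) (r : ι → ι → Prop) :
    Submodule.span ℂ (Set.range fun B : {B // B ∈ basisSet x y k} =>
      pProd (joint x y) (activeSet x y r B)) ≤ pSpace x k := by
  rw [Submodule.span_le]
  rintro _ ⟨B, rfl⟩
  exact pProd_activeSet_mem_pSpace hk hM B.2

theorem span_activeSet_eq (hk : Solid x k) (hM : LongEnough x k M) (hy : GeneralPosition x y)
    (hdim : Module.finrank ℂ (pSpace x k) = (basisSet x y k).ncard) (r : ι → ι → Prop)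
    [IsStrictTotalOrder ι r] :
    Submodule.span ℂ (Set.range fun B : {B // B ∈ basisSet x y k} =>
      pProd (joint x y) (activeSet x y r B)) = pSpace x k :=
  Submodule.eq_of_le_of_finrank_eq (span_activeSet_le hk hM r)
    ((finrank_span_activeSet hk hy r).trans hdim.symm)

theorem exists_isStrictTotalOrder (ι : Type*) : ∃ r : ι → ι → Prop, IsStrictTotalOrder ι r :=
  ⟨WellOrderingRel, inferInstance⟩

theorem isCompl_pSpace_jIdeal (hk : Solid x k) (hM : LongEnough x k M) (hy : GeneralPosition x y)
    (hdim : Module.finrank ℂ (pSpace x k) = (basisSet x y k).ncard) :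
    IsCompl (pSpace x k) ((jIdeal x y k).restrictScalars ℂ) := by
  obtain ⟨r, hr⟩ := exists_isStrictTotalOrder ι
  rw [← span_activeSet_eq hk hM hy hdim r]
  exact isCompl_span_activeSet hk hy r

end Homogeneous

/-! ### Duality of P_k and D_k -/

section Duality

variable {n : ℕ}

/-- The Taylor coefficient `(D^m f)(0)`. -/
noncomputable def taylor (m : Fin n →₀ ℕ) (f : MvPolynomial (Fin n) ℂ) : ℂ :=
  (∏ i, (m i).factorial : ℕ) * coeff m f

theorem taylor_pderiv (m : Fin n →₀ ℕ) (i : Fin n) (f : MvPolynomial (Fin n) ℂ) :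
    taylor m (pderiv i f) = taylor (m + Finsupp.single i 1) f := by
  have : ∏ j, ((m + Finsupp.single i 1 : Fin n →₀ ℕ) j).factorial = (∏ j, (m j).factorial) * (m i + 1) := by
    rw [← Finset.mul_prod_erase _ _ (Finset.mem_univ i),
      ← Finset.mul_prod_erase _ (fun j => (m j).factorial) (Finset.mem_univ i),
      Finset.prod_congr rfl (g := fun j => (m j).factorial)]
    · simp [Nat.factorial_succ]
      ring
    · intro j hj
      rw [Finsupp.add_apply, Finsupp.single_eq_of_ne (Finset.ne_of_mem_erase hj), add_zero]
  rw [taylor, taylor, coeff_pderiv, this]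
  push_cast
  ring

theorem taylor_pderiv_pow (m : Fin n →₀ ℕ) (i : Fin n) (a : ℕ) (f : MvPolynomial (Fin n) ℂ) :
    taylor m ((((pderiv i).toLinearMap : Module.End ℂ (MvPolynomial (Fin n) ℂ)) ^ a) f) =
      taylor (m + Finsupp.single i a) f := by
  induction a generalizing m with
  | zero => simp
  | succ a ih =>
    rw [pow_succ', Module.End.mul_apply]
    change taylor m (pderiv i _) = _
    rw [taylor_pderiv, ih, add_assoc, ← Finsupp.single_add, add_comm 1 a]

theorem taylor_list_prod (l : List (Fin n)) (d : Fin n → ℕ) (m : Fin n →₀ ℕ)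
    (f : MvPolynomial (Fin n) ℂ) :
    taylor m ((l.map fun i =>
      ((pderiv i).toLinearMap : Module.End ℂ (MvPolynomial (Fin n) ℂ)) ^ d i).prod f) =
      taylor (m + (l.map fun i => Finsupp.single i (d i)).sum) f := by
  induction l generalizing m with
  | nil => simp
  | cons i l ih =>
    rw [List.map_cons, List.prod_cons, Module.End.mul_apply, taylor_pderiv_pow, ih, List.map_cons,
      List.sum_cons, add_assoc]

theorem taylor_diffOp_monomial (m d : Fin n →₀ ℕ) (f : MvPolynomial (Fin n) ℂ) :
    taylor m (diffOp n (monomial d 1) f) = taylor (m + d) f := by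
  have h : diffOp n (monomial d 1) = (List.ofFn fun i : Fin n =>
      ((pderiv i).toLinearMap : Module.End ℂ (MvPolynomial (Fin n) ℂ)) ^ d i).prod := by
    have := (basisMonomials (Fin n) ℂ).constr_basis ℂ (fun d => (List.ofFn fun i : Fin n =>
      ((pderiv i).toLinearMap : Module.End ℂ (MvPolynomial (Fin n) ℂ)) ^ d i).prod) d
    rwa [coe_basisMonomials] at this
  rw [h, List.ofFn_eq_map, taylor_list_prod, ← List.ofFn_eq_map, List.sum_ofFn,
    Finsupp.univ_sum_single]

theorem pairing_monomial (d : Fin n →₀ ℕ) (f : MvPolynomial (Fin n) ℂ) :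
    pairing n (monomial d 1) f = taylor d f := by
  have : pairing n (monomial d 1) f = taylor 0 (diffOp n (monomial d 1) f) := by
    simp [pairing, taylor, lcoeff]
  rw [this, taylor_diffOp_monomial, zero_add]

theorem linearMap_ext_monomial {W : Type*} [AddCommGroup W] [Module ℂ W]
    {φ ψ : MvPolynomial (Fin n) ℂ →ₗ[ℂ] W} (h : ∀ d, φ (monomial d 1) = ψ (monomial d 1)) :
    φ = ψ :=
  (basisMonomials (Fin n) ℂ).ext fun d => by simpa using h d

/-- `taylor m`, as a linear map. -/
noncomputable def taylorₗ (m : Fin n →₀ ℕ) : MvPolynomial (Fin n) ℂ →ₗ[ℂ] ℂ :=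
  ((∏ i, (m i).factorial : ℕ) : ℂ) • lcoeff ℂ m

theorem taylorₗ_apply (m : Fin n →₀ ℕ) (f : MvPolynomial (Fin n) ℂ) :
    taylorₗ m f = taylor m f := rfl

/-- All Taylor coefficients of p(D)f are pairings of f with multiples of p. For p in an ideal, this
lets the condition p(D)f = 0 be tested at the origin only. -/
theorem taylor_diffOp (m : Fin n →₀ ℕ) (p f : MvPolynomial (Fin n) ℂ) :
    taylor m (diffOp n p f) = pairing n (monomial m 1 * p) f := by
  have : taylorₗ m ∘ₗ LinearMap.flip (diffOp n) f =
      (pairing n).flip f ∘ₗ LinearMap.mulLeft ℂ (monomial m 1) := by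
    refine linearMap_ext_monomial fun d => ?_
    rw [LinearMap.comp_apply, LinearMap.comp_apply, LinearMap.flip_apply, LinearMap.flip_apply,
      LinearMap.mulLeft_apply, taylorₗ_apply, taylor_diffOp_monomial, monomial_mul, mul_one, pairing_monomial]
  exact LinearMap.congr_fun this p

theorem eq_zero_of_taylor {f : MvPolynomial (Fin n) ℂ} (h : ∀ m, taylor m f = 0) : f = 0 := by
  ext m
  have : ((∏ i, (m i).factorial : ℕ) : ℂ) ≠ 0 :=
    Nat.cast_ne_zero.2 (Finset.prod_ne_zero_iff.2 fun i _ => Nat.factorial_ne_zero _)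
  simpa [this] using (mul_eq_zero.1 (h m)).resolve_left this

theorem eq_zero_of_pairing {f : MvPolynomial (Fin n) ℂ} (h : ∀ p, pairing n p f = 0) : f = 0 :=
  eq_zero_of_taylor fun m => by rw [← pairing_monomial, h]

/-- A functional that vanishes on all monomials of large degree is given by a polynomial. -/
theorem exists_pairing_eq (φ : MvPolynomial (Fin n) ℂ →ₗ[ℂ] ℂ) (N : ℕ)
    (hφ : ∀ d : Fin n →₀ ℕ, N < d.degree → φ (monomial d 1) = 0) :
    ∃ f, ∀ p, pairing n p f = φ p := by
  have hfin : {d : Fin n →₀ ℕ | d.degree ≤ N}.Finite := Finsupp.finite_of_degree_le N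
  refine ⟨∑ d ∈ hfin.toFinset,
    monomial d (φ (monomial d 1) / (∏ i, (d i).factorial : ℕ)), fun p => ?_⟩
  suffices (pairing n).flip _ = φ from LinearMap.congr_fun this p
  refine linearMap_ext_monomial fun d => ?_
  rw [LinearMap.flip_apply, pairing_monomial, taylor, coeff_sum]
  have hne : ((∏ i, (d i).factorial : ℕ) : ℂ) ≠ 0 :=
    Nat.cast_ne_zero.2 (Finset.prod_ne_zero_iff.2 fun i _ => Nat.factorial_ne_zero _)
  simp only [coeff_monomial, Finset.sum_ite_eq', Set.Finite.mem_toFinset, Set.mem_ofPred_eq]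
  split_ifs with h
  · field_simp
  · rw [hφ d (not_le.1 h), mul_zero]

variable {ι : Type*} {M : ℕ} {x : ι → Fin n → ℝ}
  {y : Fin M → Fin n → ℝ} {k : Finset ι → ℕ}

theorem mem_dSpace_iff {f : MvPolynomial (Fin n) ℂ} :
    f ∈ dSpace x y k ↔ ∀ p ∈ jIdeal x y k, pairing n p f = 0 := by
  simp only [dSpace, Submodule.mem_iInf, LinearMap.mem_ker]
  constructor
  · intro h p hp
    have : pairing n p f = lcoeff ℂ 0 (diffOp n p f) := rfl
    rw [this, h p hp, map_zero]
  · intro h p hp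
    exact eq_zero_of_taylor fun m => by rw [taylor_diffOp, h _ (Ideal.mul_mem_left _ _ hp)]

theorem homogeneousComponent_mem_jIdeal {p : MvPolynomial (Fin n) ℂ} (hp : p ∈ jIdeal x y k)
    (e : ℕ) : homogeneousComponent e p ∈ jIdeal x y k := by
  suffices (jIdeal x y k).restrictScalars ℂ ≤
    ((jIdeal x y k).restrictScalars ℂ).comap (homogeneousComponent e) from this hp
  conv_lhs => rw [jIdeal_eq_span]
  rw [Submodule.span_le]
  rintro _ ⟨u, rfl⟩
  change homogeneousComponent e (monomial u.1 (1 : ℂ) * pProd (joint x y) u.2) ∈ jIdeal x y k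
  rw [homogeneousComponent_of_mem (isHomogeneous_monomial_mul_pProd _ _ _)]
  split_ifs
  · exact Ideal.mul_mem_left _ _ (Ideal.subset_span ⟨u.2, u.2.2, rfl⟩)
  · exact zero_mem _

variable [Fintype ι] [DecidableEq ι]

theorem exists_totalDegree_le (x : ι → Fin n → ℝ) (k : Finset ι → ℕ) :
    ∃ N, ∀ p ∈ pSpace x k, p.totalDegree ≤ N := by
  obtain ⟨t, ht⟩ := (Submodule.fg_iff_finiteDimensional (pSpace x k)).2 inferInstance
  refine ⟨t.sup totalDegree, fun p hp => ?_⟩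
  rw [← mem_restrictTotalDegree]
  suffices pSpace x k ≤ restrictTotalDegree (Fin n) ℂ (t.sup totalDegree) from this hp
  rw [← ht, Submodule.span_le]
  exact fun q hq => (mem_restrictTotalDegree _ _ _).2 (Finset.le_sup hq)

/-- P_k has bounded degree and J_k is graded: if a monomial of larger degree is written as p + j,
its top component is a component of j. -/
theorem monomial_mem_jIdeal (h : IsCompl (pSpace x k) ((jIdeal x y k).restrictScalars ℂ)) :
    ∃ N, ∀ d : Fin n →₀ ℕ, N < d.degree → monomial d (1 : ℂ) ∈ jIdeal x y k := by
  obtain ⟨N, hN⟩ := exists_totalDegree_le x k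
  refine ⟨N, fun d hd => ?_⟩
  obtain ⟨p, hp, j, hj, hpj⟩ := Submodule.mem_sup.1
    (h.sup_eq_top.ge (Submodule.mem_top (x := monomial d (1 : ℂ))))
  have h1 := congrArg (homogeneousComponent d.degree) hpj
  rw [map_add, homogeneousComponent_eq_zero _ _ ((hN p hp).trans_lt hd), zero_add,
    homogeneousComponent_of_mem (isHomogeneous_monomial (1 : ℂ) rfl), if_pos rfl] at h1
  rw [← h1]
  exact homogeneousComponent_mem_jIdeal hj _

theorem bijective_pairing (h : IsCompl (pSpace x k) ((jIdeal x y k).restrictScalars ℂ)) :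
    Function.Bijective ((pairing n).domRestrict₁₂ (pSpace x k) (dSpace x y k)) := by
  -- As P_k is finite-dimensional, nondegeneracy on both sides suffices. For p ∉ J_k, a functional
  -- that kills J_k but not p kills all large monomials, hence is the pairing with a polynomial,
  -- which lies in D_k.
  refine (LinearMap.IsPerfPair.of_injective ?_ ?_).bijective_left
  · rw [injective_iff_map_eq_zero]
    rintro ⟨p, hp⟩ hpz
    by_contra hne
    have hpJ : p ∉ (jIdeal x y k).restrictScalars ℂ := fun hpJ =>
      hne (Subtype.ext (Submodule.disjoint_def.1 h.disjoint p hp hpJ))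
    obtain ⟨φ, hφ, hJ⟩ := Submodule.exists_le_ker_of_notMem hpJ
    obtain ⟨N, hN⟩ := monomial_mem_jIdeal h
    obtain ⟨f, hf⟩ := exists_pairing_eq φ N fun d hd => hJ (hN d hd)
    have hfD : f ∈ dSpace x y k := mem_dSpace_iff.2 fun q hq => (hf q).trans (hJ hq)
    exact hφ ((hf p).symm.trans (LinearMap.congr_fun hpz ⟨f, hfD⟩))
  · rw [injective_iff_map_eq_zero]
    rintro ⟨f, hf⟩ hfz
    refine Subtype.ext (eq_zero_of_pairing fun p => ?_)
    obtain ⟨q, hq, j, hj, rfl⟩ := Submodule.mem_sup.1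
      (h.sup_eq_top.ge (Submodule.mem_top (x := p)))
    rw [map_add, LinearMap.add_apply, mem_dSpace_iff.1 hf j hj, add_zero]
    exact LinearMap.congr_fun hfz ⟨q, hq⟩

end Duality

/-! ### The Lagrange basis -/

section Lagrange

variable {ι : Type*} {n M : ℕ} {x : ι → Fin n → ℝ} {y : Fin M → Fin n → ℝ} {k : Finset ι → ℕ}

theorem real_smul_eq_C_mul (a : ℝ) (f : MvPolynomial (Fin n) ℂ) : a • f = C (a : ℂ) * f := by
  ext m
  simp [coeff_C_mul]

theorem totalDegree_qProd_le {E : Type*} (V : E → Fin n → ℝ) (c : E → ℝ) (Z : Finset E) :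
    (qProd V c Z).totalDegree ≤ Z.card := by
  refine (totalDegree_finsetProd _ _).trans ((Finset.sum_le_card_nsmul _ _ 1 fun z _ => ?_).trans
    (by simp))
  refine (totalDegree_sub _ _).trans (max_le (isHomogeneous_linForm _).totalDegree_le ?_)
  rw [totalDegree_C]
  exact zero_le_one

theorem qProd_joint (c : ι ⊕ Fin M → ℝ) (S : Finset (ι ⊕ Fin M)) :
    qProd (joint x y) c S = qProd x (c ∘ Sum.inl) S.toLeft * qProd y (c ∘ Sum.inr) S.toRight := by
  conv_lhs => rw [← Finset.toLeft_disjSum_toRight (u := S)]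
  simp [qProd, Finset.prod_disjSum, affForm]

theorem affForm_eq_sum {E : Type*} {V : E → Fin n → ℝ} {B : Finset E} (hB : IsBasis V B)
    (c : E → ℝ) (e : E) : ∃ d : ℂ, affForm V c e =
      ∑ z : {z // z ∈ B}, C ((hB.basis.repr (V e) z : ℝ) : ℂ) * affForm V c z + C d := by
  refine ⟨∑ z : {z // z ∈ B}, ((hB.basis.repr (V e) z : ℝ) : ℂ) * c z - c e, ?_⟩
  have h : linForm (V e) =
      ∑ z : {z // z ∈ B}, C ((hB.basis.repr (V e) z : ℝ) : ℂ) * linForm (V z) := by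
    have h1 := congrArg (linFormₗ n) (hB.basis.sum_repr (V e))
    rw [map_sum] at h1
    rw [← linFormₗ_apply, ← h1]
    refine Finset.sum_congr rfl fun z _ => ?_
    rw [map_smul, real_smul_eq_C_mul, linFormₗ_apply, hB.basis_apply]
  simp only [affForm, mul_sub, Finset.sum_sub_distrib]
  rw [← h, C_sub, map_sum]
  simp only [C_mul]
  ring

variable [DecidableEq ι]

/-- Expanding q_{y'} along B cancels the subtracted terms. This form of ℓ_B, with only the terms of
I ∖ I'' and a constant left, gives membership in P_k; the defining form gives the values at
vertices. -/
theorem exists_lagrangeL_eq {c : ι ⊕ Fin M → ℝ} {B : Finset (ι ⊕ Fin M)}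
    (hB : IsBasis (joint x y) B) (h : extNum n k B.toLeft < M) : ∃ d : ℂ,
      lagrangeL x y k c B hB = ∑ z : {z // z ∈ B}, (if (z : ι ⊕ Fin M) ∈ lagrangeSupport k B then 0
        else C ((hB.basis.repr (y ⟨extNum n k B.toLeft, h⟩) z : ℝ) : ℂ) *
          affForm (joint x y) c z) + C d := by
  obtain ⟨d, hd⟩ := affForm_eq_sum hB c (Sum.inr ⟨extNum n k B.toLeft, h⟩)
  refine ⟨d, ?_⟩
  rw [lagrangeL, dif_pos h, hd, add_sub_right_comm, ← Finset.sum_sub_distrib]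
  congr 1
  refine Finset.sum_congr rfl fun z _ => ?_
  split_ifs
  · exact sub_self _
  · exact sub_zero _

theorem evalAt_lagrangeL {c : ι ⊕ Fin M → ℝ} {B : Finset (ι ⊕ Fin M)}
    (hB : IsBasis (joint x y) B) (h : extNum n k B.toLeft < M) {v : Fin n → ℝ}
    (hv : ∀ z ∈ B, z ∈ lagrangeSupport k B → evalAt v (affForm (joint x y) c z) = 0) :
    evalAt v (lagrangeL x y k c B hB) =
      evalAt v (affForm (joint x y) c (Sum.inr ⟨extNum n k B.toLeft, h⟩)) := by
  rw [lagrangeL, dif_pos h, evalAt, map_sub, map_sum, Finset.sum_eq_zero, sub_zero]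
  · rfl
  · intro z _
    split_ifs with hz
    · have := hv z z.2 hz
      rw [evalAt] at this
      rw [map_mul, this, mul_zero]
    · exact map_zero _

variable [Fintype ι]

/-- Expanding q_{X ∖ Z} gives multiples of the p_{X ∖ (Z ∪ T)}, and g remains admissible because
k(Z) ≤ k(Z ∪ T). -/
theorem qProd_mul_mem_pSpace (hk : Solid x k) (c : ι → ℝ) {Z : Finset ι}
    {g : MvPolynomial (Fin n) ℂ} (hg : g.totalDegree ≤ k Z) :
    qProd x c (Finset.univ \ Z) * g ∈ pSpace x k := by
  rw [qProd]
  simp only [affForm]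
  rw [Finset.prod_sub, Finset.sum_mul]
  refine Submodule.sum_mem _ fun T hT => ?_
  have h1 := pProd_mul_mem_pSpace (x := x) (hg.trans (hk.mono (Finset.subset_union_left (s₂ := T))))
  rw [← Finset.sup_eq_union, ← sdiff_sdiff_left, pProd] at h1
  have h2 := Submodule.smul_mem _ ((-1) ^ T.card * ∏ i ∈ T, (c i : ℂ)) h1
  rw [smul_eq_C_mul, C_mul, C_pow, C_neg, C_1, map_prod] at h2
  convert h2 using 1
  ring

/-- The Y-part of Q_B has degree at most k(I), so Q_B ∈ P_k. A term q_a of ℓ_B with a ∈ I ∖ I''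
joins the X-part, turning X ∖ I into X ∖ (I ∖ a), and k(I ∖ a) = k(I) still bounds the degree of the
Y-part. -/
theorem lagrange_mem_pSpace (hk : Solid x k) (hM : LongEnough x k M) (c : ι ⊕ Fin M → ℝ)
    (B : {B // B ∈ basisSet x y k}) : lagrange x y k c B ∈ pSpace x k := by
  obtain ⟨B, hBk⟩ := B
  have hB := hBk.1
  set Ym := Finset.univ.filter fun j : Fin M => (j : ℕ) < extNum n k B.toLeft with hYm
  have hdeg : (qProd y (c ∘ Sum.inr) (Ym \ B.toRight)).totalDegree ≤ k B.toLeft :=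
    (totalDegree_qProd_le _ _ _).trans (card_filter_sdiff_toRight hM hBk).le
  have hQ : lagrangeQ x y k c B =
      qProd x (c ∘ Sum.inl) (Finset.univ \ B.toLeft) *
        qProd y (c ∘ Sum.inr) (Ym \ B.toRight) := by
    rw [lagrangeQ, qProd_joint]
    congr 2 <;> ext z <;> simp [Ym]
  have hQmem : lagrangeQ x y k c B ∈ pSpace x k := by
    rw [hQ]
    exact qProd_mul_mem_pSpace hk _ hdeg
  rw [lagrange]
  by_cases h : extNum n k B.toLeft < M
  · obtain ⟨d, hd⟩ := exists_lagrangeL_eq (c := c) hB h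
    rw [hd, mul_add, Finset.mul_sum]
    refine add_mem (Submodule.sum_mem _ fun z _ => ?_) ?_
    · split_ifs with hz
      · rw [mul_zero]
        exact zero_mem _
      · rw [mul_left_comm, ← smul_eq_C_mul]
        refine Submodule.smul_mem _ _ ?_
        obtain ⟨z, hzB⟩ := z
        rcases z with a | j
        · have ha : a ∈ B.toLeft := Finset.mem_toLeft.2 hzB
          have hka : k B.toLeft ≤ k (B.toLeft.erase a) := by
            by_contra hlt
            refine hz (Finset.inl_mem_disjSum.2 (Finset.mem_filter.2 ⟨ha, not_le.1 hlt⟩))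
          have : Finset.univ \ B.toLeft.erase a = insert a (Finset.univ \ B.toLeft) := by
            ext b
            by_cases hb : b = a <;> simp [hb]
          have hQa : lagrangeQ x y k c B * affForm (joint x y) c (Sum.inl a) =
              qProd x (c ∘ Sum.inl) (Finset.univ \ B.toLeft.erase a) *
                qProd y (c ∘ Sum.inr) (Ym \ B.toRight) := by
            have hins : qProd x (c ∘ Sum.inl) (insert a (Finset.univ \ B.toLeft)) =
                affForm (joint x y) c (Sum.inl a) *
                  qProd x (c ∘ Sum.inl) (Finset.univ \ B.toLeft) :=
              Finset.prod_insert fun h => (Finset.mem_sdiff.1 h).2 ha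
            rw [hQ, this, hins]
            ring
          rw [hQa]
          exact qProd_mul_mem_pSpace hk _ (hdeg.trans hka)
        · exact absurd (Finset.inr_mem_disjSum.2 (Finset.mem_toRight.2 hzB)) hz
    · rw [mul_comm, ← smul_eq_C_mul]
      exact Submodule.smul_mem _ _ hQmem
  · rw [lagrangeL, dif_neg h, mul_one]
    exact hQmem

theorem evalAt_lagrange_self {c : ι ⊕ Fin M → ℝ}
    (hc : Generic (joint x y) c) (B : {B // B ∈ basisSet x y k}) :
    evalAt (B.2.1.vertex c) (lagrange x y k c B) ≠ 0 := by
  have hB := B.2.1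
  rw [lagrange, evalAt_mul, lagrangeQ, evalAt_qProd]
  refine mul_ne_zero (Finset.prod_ne_zero_iff.2 fun z hz =>
    hc.evalAt_vertex_ne_zero hB (Finset.mem_sdiff.1 hz).2) ?_
  by_cases h : extNum n k (B : Finset (ι ⊕ Fin M)).toLeft < M
  · rw [evalAt_lagrangeL hB h fun z hz _ => evalAt_vertex hB hz]
    refine hc.evalAt_vertex_ne_zero hB fun h' => ?_
    exact lt_irrefl _ (B.2.2 _ (Finset.mem_toRight.2 h'))
  · rw [lagrangeL, dif_neg h, evalAt, map_one]
    exact one_ne_zero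

/-- If B' contains an element of X ∪ Y_{m(I)} outside B, then Q_B vanishes at b(B'). Otherwise
counting is tight and forces B' to contain y', J and I'', so that every term of ℓ_B vanishes there.
-/
theorem evalAt_lagrange_of_ne (hk : Solid x k) (hM : LongEnough x k M) {c : ι ⊕ Fin M → ℝ}
    {B B' : {B // B ∈ basisSet x y k}} (hne : B' ≠ B) :
    evalAt (B'.2.1.vertex c) (lagrange x y k c B) = 0 := by
  obtain ⟨B, hBk⟩ := B
  obtain ⟨B', hBk'⟩ := B'
  have hB := hBk.1
  have hB' := hBk'.1
  rw [lagrange, evalAt_mul, lagrangeQ, evalAt_qProd]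
  by_cases hex : ∃ z ∈ (Finset.univ.disjSum
      (Finset.univ.filter fun j : Fin M => (j : ℕ) < extNum n k B.toLeft)) \ B, z ∈ B'
  · obtain ⟨z, hz, hzB'⟩ := hex
    rw [Finset.prod_eq_zero hz (evalAt_vertex hB' hzB'), zero_mul]
  push Not at hex
  have hleft : B'.toLeft ⊆ B.toLeft := by
    intro a ha
    by_contra h
    exact hex (Sum.inl a) (Finset.mem_sdiff.2 ⟨by simp, fun h' => h (Finset.mem_toLeft.2 h')⟩)
      (Finset.mem_toLeft.1 ha)
  have hright : ∀ j ∈ B'.toRight, (j : ℕ) < extNum n k B.toLeft → j ∈ B.toRight := by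
    intro j hj hlt
    by_contra h
    exact hex (Sum.inr j) (Finset.mem_sdiff.2 ⟨by simpa using hlt,
      fun h' => h (Finset.mem_toRight.2 h')⟩) (Finset.mem_toRight.1 hj)
  have hkk : k B'.toLeft ≤ k B.toLeft := hk.mono hleft
  have hcl := Finset.card_le_card hleft
  have h1 := hB.card_toLeft_add
  have h2 := hB'.card_toLeft_add
  set U := Finset.univ.filter fun j : Fin M =>
    extNum n k B.toLeft ≤ (j : ℕ) ∧ (j : ℕ) < extNum n k B'.toLeft with hU
  have hUc : U.card ≤ extNum n k B'.toLeft - extNum n k B.toLeft := card_filter_fin_le _ _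
  have hsub : B'.toRight ⊆ B.toRight ∪ U := by
    intro j hj
    rw [Finset.mem_union]
    by_cases hlt : (j : ℕ) < extNum n k B.toLeft
    · exact Or.inl (hright j hj hlt)
    · exact Or.inr (Finset.mem_filter.2 ⟨Finset.mem_univ j, not_lt.1 hlt, hBk'.2 j hj⟩)
  have hcard := (Finset.card_le_card hsub).trans (Finset.card_union_le _ _)
  have hne' : ¬ (B'.toLeft = B.toLeft ∧ B'.toRight = B.toRight) := by
    rintro ⟨h3, h4⟩
    refine hne (Subtype.ext ?_)
    change B' = B
    rw [← Finset.toLeft_disjSum_toRight (u := B'), h3, h4, Finset.toLeft_disjSum_toRight]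
  -- Without this inequality U is empty and B' ⊆ B, so the two bases coincide.
  have hlt : extNum n k B.toLeft < extNum n k B'.toLeft := by
    by_contra hle
    have hU0 : U = ∅ := Finset.card_eq_zero.1 (by omega)
    rw [hU0, Finset.union_empty] at hsub
    have hcr := Finset.card_le_card hsub
    exact hne' ⟨Finset.eq_of_subset_of_card_le hleft (by omega),
      Finset.eq_of_subset_of_card_le hsub (by omega)⟩
  -- The bound #(B' ∩ Y) ≤ #(B ∩ Y) + #U reads k(B ∩ X) ≤ k(B' ∩ X), while monotonicity gives the
  -- converse; hence equality holds throughout.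
  have hkeq : k B'.toLeft = k B.toLeft := by
    simp only [extNum] at *
    omega
  have heq : B'.toRight = B.toRight ∪ U := by
    refine Finset.eq_of_subset_of_card_le hsub ((Finset.card_union_le _ _).trans ?_)
    simp only [extNum] at *
    omega
  have hM' : extNum n k B'.toLeft ≤ M := hM _ hB'.indep.toLeft
  have hm : extNum n k B.toLeft < M := hlt.trans_le hM'
  have hsupp : ∀ z ∈ B, z ∈ lagrangeSupport k B → z ∈ B' := by
    intro z _ hz
    rcases z with a | j
    · have ha := Finset.mem_filter.1 (Finset.inl_mem_disjSum.1 hz)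
      by_contra haB'
      -- If a ∈ I'' were missing from B', then k(B' ∩ X) ≤ k(I ∖ a) < k(I).
      have := hk.mono (x := x) (Z := B'.toLeft) (Z' := B.toLeft.erase a) fun b hb =>
        Finset.mem_erase.2 ⟨fun h => haB' (Finset.mem_toLeft.1 (h ▸ hb)), hleft hb⟩
      omega
    · refine Finset.mem_toRight.1 ?_
      rw [heq]
      exact Finset.mem_union_left _ (Finset.inr_mem_disjSum.1 hz)
  have hy' : Sum.inr ⟨extNum n k B.toLeft, hm⟩ ∈ B' := by
    refine Finset.mem_toRight.1 ?_
    rw [heq]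
    exact Finset.mem_union_right _ (Finset.mem_filter.2 ⟨Finset.mem_univ _, le_rfl, hlt⟩)
  rw [evalAt_lagrangeL hB hm fun z hz hz' => evalAt_vertex hB' (hsupp z hz hz'),
    evalAt_vertex hB' hy', mul_zero]

theorem evalAt_lagrange_eq_zero_iff (hk : Solid x k) (hM : LongEnough x k M)
    {c : ι ⊕ Fin M → ℝ} (hc : Generic (joint x y) c) (B B' : {B // B ∈ basisSet x y k}) :
    evalAt (B'.2.1.vertex c) (lagrange x y k c B) = 0 ↔ B' ≠ B := by
  refine ⟨?_, evalAt_lagrange_of_ne hk hM⟩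
  rintro h rfl
  exact evalAt_lagrange_self hc _ h

theorem isBasisOf_lagrange (hk : Solid x k) (hM : LongEnough x k M)
    (hdim : Module.finrank ℂ (pSpace x k) = (basisSet x y k).ncard) {c : ι ⊕ Fin M → ℝ}
    (hc : Generic (joint x y) c) : IsBasisOf (lagrange x y k c) (pSpace x k) := by
  classical
  have hli : LinearIndependent ℂ (lagrange x y k c) :=
    linearIndependent_of_evalAt (evalAt_lagrange_eq_zero_iff hk hM hc)
  refine ⟨hli, Submodule.eq_of_le_of_finrank_eq ?_ ?_⟩
  · rw [Submodule.span_le]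
    rintro _ ⟨B, rfl⟩
    exact lagrange_mem_pSpace hk hM c B
  · rw [finrank_span_eq_card hli, hdim, ← Nat.card_coe_set_eq, Nat.card_eq_fintype_card]

end Lagrange

/-! ### Degrees along lines orthogonal to C -/

section Lines

open Filter Topology

variable {E : Type*} {n : ℕ} {V : E → Fin n → ℝ}

/-- The vector `t` is orthogonal to the vectors of `C`. -/
def Perp (V : E → Fin n → ℝ) (C : Finset E) (t : Fin n → ℝ) : Prop := ∀ c ∈ C, V c ⬝ᵥ t = 0

theorem Perp.add_smul {C : Finset E} {t u : Fin n → ℝ} (ht : Perp V C t) (hu : Perp V C u) (a : ℝ) :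
    Perp V C (t + a • u) := fun c hc => by
  rw [dotProduct_add, dotProduct_smul, ht c hc, hu c hc, smul_zero, add_zero]

theorem Perp.mono {C C' : Finset E} {t : Fin n → ℝ} (ht : Perp V C' t) (h : C ⊆ C') :
    Perp V C t := fun c hc => ht c (h hc)

theorem Perp.dotProduct_eq_zero {C : Finset E} {t v : Fin n → ℝ} (ht : Perp V C t)
    (hv : v ∈ spanOf V C) : v ⬝ᵥ t = 0 := by
  suffices spanOf V C ≤ LinearMap.ker ((dotProductBilin ℝ ℝ).flip t) from this hv
  rw [spanOf_le]
  exact fun c hc => ht c hc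

theorem exists_perp_ne_zero {C : Finset E} {v : Fin n → ℝ} (hv : v ∉ spanOf V C) :
    ∃ u, Perp V C u ∧ v ⬝ᵥ u ≠ 0 := by
  obtain ⟨φ, hφ, hC⟩ := Submodule.exists_le_ker_of_notMem hv
  have key : ∀ w, φ w = w ⬝ᵥ fun i => φ (Pi.single i 1) := by
    intro w
    conv_lhs => rw [← (Pi.basisFun ℝ (Fin n)).sum_repr w]
    simp [dotProduct]
  refine ⟨fun i => φ (Pi.single i 1), fun c hc => ?_, ?_⟩
  · rw [← key]
    exact hC (mem_spanOf hc)
  · rwa [← key]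

/-- Restriction of polynomials to the line `t + s η`. -/
noncomputable def lineP (t η : Fin n → ℝ) : MvPolynomial (Fin n) ℂ →ₐ[ℂ] Polynomial ℂ :=
  aeval fun i => Polynomial.C (t i : ℂ) + Polynomial.C (η i : ℂ) * Polynomial.X

theorem lineP_linForm (t η v : Fin n → ℝ) : lineP t η (linForm v) =
    Polynomial.C ((v ⬝ᵥ t : ℝ) : ℂ) + Polynomial.C ((v ⬝ᵥ η : ℝ) : ℂ) * Polynomial.X := by
  simp only [lineP, linForm, map_sum, map_mul, aeval_X, algHom_C, dotProduct, Complex.ofReal_sum,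
    Complex.ofReal_mul, Finset.sum_mul, ← Finset.sum_add_distrib]
  refine Finset.sum_congr rfl fun i _ => ?_
  rw [Polynomial.algebraMap_eq]
  ring

theorem mem_degreeLT_iff {D : ℕ} {P : Polynomial ℂ} :
    P ∈ Polynomial.degreeLT ℂ D ↔ ∀ j, D ≤ j → P.coeff j = 0 := by
  rw [Polynomial.mem_degreeLT, Polynomial.degree_lt_iff_coeff_zero]

theorem continuous_coeff_lineP (t u η w : Fin n → ℝ) (f : MvPolynomial (Fin n) ℂ) (j : ℕ) :
    Continuous fun a : ℝ => (lineP (t + a • u) (η + a • w) f).coeff j := by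
  induction f using MvPolynomial.induction_on generalizing j with
  | C c =>
    simp only [lineP, algHom_C]
    exact continuous_const
  | add p q hp hq =>
    simp only [map_add, Polynomial.coeff_add]
    exact (hp j).add (hq j)
  | mul_X p i hp =>
    have h1 : Continuous fun a : ℝ => (((t + a • u) i : ℝ) : ℂ) := by
      simp only [Pi.add_apply, Pi.smul_apply]; fun_prop
    have h2 : Continuous fun a : ℝ => (((η + a • w) i : ℝ) : ℂ) := by
      simp only [Pi.add_apply, Pi.smul_apply]; fun_prop
    have hX : ∀ a : ℝ, lineP (t + a • u) (η + a • w) (X i) = Polynomial.C (((t + a • u) i : ℝ) : ℂ) +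
        Polynomial.C (((η + a • w) i : ℝ) : ℂ) * Polynomial.X := fun a => by
      rw [lineP, aeval_X]
    simp only [map_mul, hX, mul_add, ← mul_assoc, Polynomial.coeff_add]
    cases j with
    | zero =>
      simp only [Polynomial.mul_coeff_zero, Polynomial.coeff_X_zero, Polynomial.coeff_C_zero,
        mul_zero, add_zero]
      exact (hp 0).mul h1
    | succ j =>
      simp only [Polynomial.coeff_mul_C, Polynomial.coeff_mul_X]
      exact ((hp _).mul h1).add ((hp _).mul h2)

/-- Having degree less than `D` is a closed condition on lines. -/
theorem lineP_mem_degreeLT_of_eventually {t u η w : Fin n → ℝ} {f : MvPolynomial (Fin n) ℂ}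
    {D : ℕ} (h : ∀ᶠ a in 𝓝[≠] (0 : ℝ), lineP (t + a • u) (η + a • w) f ∈ Polynomial.degreeLT ℂ D) :
    lineP t η f ∈ Polynomial.degreeLT ℂ D := by
  rw [mem_degreeLT_iff]
  intro j hj
  have hc := ((continuous_coeff_lineP t u η w f j).tendsto 0).mono_left
    (nhdsWithin_le_nhds (s := {0}ᶜ))
  have h0 : Tendsto (fun a : ℝ => (lineP (t + a • u) (η + a • w) f).coeff j) (𝓝[≠] 0) (𝓝 0) :=
    tendsto_const_nhds.congr' (h.mono fun a ha => (mem_degreeLT_iff.1 ha j hj).symm)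
  simpa using tendsto_nhds_unique hc h0

/-- The polynomials whose restrictions to the lines in direction `η` in the orthogonal complement of
`C` have degree less than `D`. -/
noncomputable def lineDeg (V : E → Fin n → ℝ) (C : Finset E) (η : Fin n → ℝ) (D : ℕ) :
    Submodule ℂ (MvPolynomial (Fin n) ℂ) :=
  ⨅ t : {t // Perp V C t}, (Polynomial.degreeLT ℂ D).comap (lineP t η).toLinearMap

theorem mem_lineDeg {C : Finset E} {η : Fin n → ℝ} {D : ℕ} {f : MvPolynomial (Fin n) ℂ} :
    f ∈ lineDeg V C η D ↔ ∀ t, Perp V C t → lineP t η f ∈ Polynomial.degreeLT ℂ D := by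
  simp [lineDeg, Submodule.mem_iInf]

theorem lineDeg_mono {C C' : Finset E} (hC : C ⊆ C') {η : Fin n → ℝ} {D D' : ℕ} (hD : D ≤ D') :
    lineDeg V C η D ≤ lineDeg V C' η D' := fun _ hf =>
  mem_lineDeg.2 fun t ht => Polynomial.degreeLT_mono hD (mem_lineDeg.1 hf t (ht.mono hC))

/-- The ideal generated by the linear forms of `C`. -/
noncomputable def formIdeal (V : E → Fin n → ℝ) (C : Finset E) : Ideal (MvPolynomial (Fin n) ℂ) :=
  Ideal.span {f | ∃ c ∈ C, f = linForm (V c)}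

theorem linForm_mem_formIdeal {C : Finset E} {c : E} (hc : c ∈ C) :
    linForm (V c) ∈ formIdeal V C :=
  Ideal.subset_span ⟨c, hc, rfl⟩

theorem exists_of_mem_formIdeal_insert [DecidableEq E] {C : Finset E} {a : E}
    {f : MvPolynomial (Fin n) ℂ} (hf : f ∈ formIdeal V (insert a C)) :
    ∃ g, f - linForm (V a) * g ∈ formIdeal V C := by
  have h : formIdeal V (insert a C) ≤ Ideal.span {linForm (V a)} ⊔ formIdeal V C := by
    refine Ideal.span_le.2 ?_
    rintro _ ⟨c, hc, rfl⟩
    rcases Finset.mem_insert.1 hc with rfl | hc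
    · exact Ideal.mem_sup_left (Ideal.mem_span_singleton_self _)
    · exact Ideal.mem_sup_right (linForm_mem_formIdeal hc)
  obtain ⟨p, hp, j, hj, rfl⟩ := Submodule.mem_sup.1 (h hf)
  obtain ⟨g, rfl⟩ := Ideal.mem_span_singleton.1 hp
  exact ⟨g, by rwa [add_sub_cancel_left]⟩

theorem formIdeal_le_lineDeg {C : Finset E} {η : Fin n → ℝ} (hη : Perp V C η) (D : ℕ) :
    (formIdeal V C).restrictScalars ℂ ≤ lineDeg V C η D := by
  intro f hf
  rw [mem_lineDeg]
  intro t ht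
  have : formIdeal V C ≤ RingHom.ker (lineP t η) := by
    refine Ideal.span_le.2 ?_
    rintro _ ⟨c, hc, rfl⟩
    change lineP t η (linForm (V c)) = 0
    simp [lineP_linForm, ht c hc, hη c hc]
  rw [show lineP t η f = 0 from this hf]
  exact zero_mem _

/-- Polynomials that vanish on the orthogonal complement of `C` are in the ideal of `C`. -/
theorem mem_formIdeal_of_evalAt {C : Finset E} {f : MvPolynomial (Fin n) ℂ}
    (h : ∀ t, Perp V C t → evalAt t f = 0) : f ∈ formIdeal V C := by
  obtain ⟨Q, hQ⟩ := (spanOf V C).exists_isCompl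
  -- Substituting for each coordinate the form of ρ(e_i) changes f only modulo the ideal of C. The
  -- substitution composes f with the transpose of ρ, which maps into C^⊥, so the result vanishes at
  -- all real points and is 0.
  let π := (spanOf V C).projection Q hQ
  let ρ : (Fin n → ℝ) →ₗ[ℝ] (Fin n → ℝ) := LinearMap.id - π
  have hρ : ∀ v ∈ spanOf V C, ρ v = 0 := fun v hv =>
    sub_eq_zero.2 (Submodule.projection_apply_of_mem_left hQ hv).symm
  have hX : ∀ i, X i - linForm (ρ (Pi.single i 1)) ∈ formIdeal V C := by
    intro i
    rw [← linForm_single, ← linFormₗ_apply, ← linFormₗ_apply, ← map_sub, linFormₗ_apply]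
    refine linForm_mem_ideal (C := C) ?_ fun c hc => linForm_mem_formIdeal hc
    rw [show Pi.single i 1 - ρ (Pi.single i 1) = π (Pi.single i 1) from sub_sub_cancel _ _]
    exact Submodule.projection_apply_mem _ _
  have hsub : ∀ g, g - bind₁ (fun i => linForm (ρ (Pi.single i 1))) g ∈ formIdeal V C := by
    intro g
    induction g using MvPolynomial.induction_on with
    | C a => simp
    | add p q hp hq =>
      rw [map_add, add_sub_add_comm]
      exact add_mem hp hq
    | mul_X p i hp =>
      rw [map_mul, bind₁_X_right]
      convert add_mem (Ideal.mul_mem_right (X i) _ hp) (Ideal.mul_mem_left _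
        (bind₁ (fun i => linForm (ρ (Pi.single i 1))) p) (hX i)) using 1
      ring
  have hzero : bind₁ (fun i => linForm (ρ (Pi.single i 1))) f = 0 := by
    refine funext_set (fun _ => Set.range ((↑) : ℝ → ℂ))
      (fun _ => Set.infinite_range_of_injective Complex.ofReal_injective) fun w hw => ?_
    choose t ht using fun i => hw i trivial
    obtain rfl : (fun i => (t i : ℂ)) = w := funext ht
    have hev : ∀ g, eval (fun i => (t i : ℂ)) (bind₁ (fun i => linForm (ρ (Pi.single i 1))) g) =
        evalAt (fun i => ρ (Pi.single i 1) ⬝ᵥ t) g := by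
      intro g
      induction g using MvPolynomial.induction_on with
      | C a => simp [evalAt]
      | add p q hp hq =>
        rw [map_add, map_add, hp, hq]
        exact (map_add _ _ _).symm
      | mul_X p i hp =>
        rw [map_mul, map_mul, hp, bind₁_X_right, evalAt_mul]
        congr 1
        simp [evalAt, linForm, dotProduct]
    rw [hev, map_zero]
    refine h _ fun c hc => ?_
    have : V c ⬝ᵥ (fun i => ρ (Pi.single i 1) ⬝ᵥ t) = ρ (V c) ⬝ᵥ t := by
      conv_rhs => rw [← (Pi.basisFun ℝ (Fin n)).sum_repr (V c)]
      rw [map_sum, sum_dotProduct]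
      refine Finset.sum_congr rfl fun i _ => ?_
      rw [map_smul, smul_dotProduct, Pi.basisFun_repr, Pi.basisFun_apply, smul_eq_mul]
    rw [this, hρ _ (mem_spanOf hc), zero_dotProduct]
  have := hsub f
  rwa [hzero, sub_zero] at this

theorem natDegree_lineP_le (t η : Fin n → ℝ) (f : MvPolynomial (Fin n) ℂ) :
    (lineP t η f).natDegree ≤ f.totalDegree := by
  have := aeval_natDegree_le (n := 1) f le_rfl
    (fun i => Polynomial.C (t i : ℂ) + Polynomial.C (η i : ℂ) * Polynomial.X) fun i => by
      rw [add_comm]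
      exact Polynomial.natDegree_linear_le
  rwa [mul_one] at this

theorem natDegree_lineP_pProd_le (t η : Fin n → ℝ) (V : E → Fin n → ℝ) (Z : Finset E) :
    (lineP t η (pProd V Z)).natDegree ≤ (Z.filter fun z => V z ⬝ᵥ η ≠ 0).card := by
  rw [pProd, map_prod, Finset.card_filter]
  refine (Polynomial.natDegree_prod_le _ _).trans (Finset.sum_le_sum fun z _ => ?_)
  rw [lineP_linForm]
  split_ifs with h
  · rw [add_comm]
    exact Polynomial.natDegree_linear_le
  · rw [not_not.1 h]
    simp

theorem mem_degreeLT_of_natDegree_le {P : Polynomial ℂ} {D : ℕ} (h : P.natDegree ≤ D) :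
    P ∈ Polynomial.degreeLT ℂ (D + 1) :=
  Polynomial.mem_degreeLT.2 (Polynomial.degree_le_natDegree.trans_lt
    (Nat.cast_lt.2 (Nat.lt_succ_of_le h)))

theorem pProd_mem_lineDeg {C Z : Finset E} {η : Fin n → ℝ} {D : ℕ}
    (h : (Z.filter fun z => V z ⬝ᵥ η ≠ 0).card ≤ D) : pProd V Z ∈ lineDeg V C η (D + 1) :=
  mem_lineDeg.2 fun t _ => mem_degreeLT_of_natDegree_le ((natDegree_lineP_pProd_le t η V Z).trans h)

/-- Along direction η the factor p_v has degree exactly one. For D = 0 the restriction of g is zero,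
in agreement with truncated subtraction. -/
theorem mem_lineDeg_of_linForm_mul {C : Finset E} {η v : Fin n → ℝ} (hv : v ⬝ᵥ η ≠ 0) {D : ℕ}
    {g : MvPolynomial (Fin n) ℂ} (h : linForm v * g ∈ lineDeg V C η D) :
    g ∈ lineDeg V C η (D - 1) := by
  rw [mem_lineDeg] at *
  intro t ht
  have h1 := h t ht
  rw [map_mul, lineP_linForm] at h1
  by_cases h0 : lineP t η g = 0
  · rw [h0]
    exact zero_mem _
  have hb : ((v ⬝ᵥ η : ℝ) : ℂ) ≠ 0 := Complex.ofReal_ne_zero.2 hv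
  rw [Polynomial.mem_degreeLT, Polynomial.degree_mul, add_comm (Polynomial.C _),
    Polynomial.degree_linear hb, Polynomial.degree_eq_natDegree h0] at h1
  rw [Polynomial.mem_degreeLT, Polynomial.degree_eq_natDegree h0]
  have h2 : 1 + (lineP t η g).natDegree < D := by exact_mod_cast h1
  exact Nat.cast_lt.2 (by omega)

/-- Here p_v is constant along each line, and nonzero on those through points t of C^⊥ with v · t ≠
0. Such t are dense in C^⊥ as v ∉ Span C, and the degree bound is a closed condition. -/
theorem mem_lineDeg_of_linForm_mul_of_eq_zero {C : Finset E} {η v : Fin n → ℝ} (hv : v ⬝ᵥ η = 0)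
    (hvC : v ∉ spanOf V C) {D : ℕ} {g : MvPolynomial (Fin n) ℂ}
    (h : linForm v * g ∈ lineDeg V C η D) : g ∈ lineDeg V C η D := by
  obtain ⟨u, hu, hvu⟩ := exists_perp_ne_zero hvC
  rw [mem_lineDeg] at *
  have key : ∀ t, Perp V C t → v ⬝ᵥ t ≠ 0 → lineP t η g ∈ Polynomial.degreeLT ℂ D := by
    intro t ht hvt
    have h1 := h t ht
    rw [map_mul, lineP_linForm, hv, Complex.ofReal_zero, map_zero, zero_mul, add_zero,
      ← Polynomial.smul_eq_C_mul] at h1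
    exact (Submodule.smul_mem_iff _ (Complex.ofReal_ne_zero.2 hvt)).1 h1
  intro t ht
  by_cases hvt : v ⬝ᵥ t = 0
  · refine lineP_mem_degreeLT_of_eventually (u := u) (w := 0) ?_
    filter_upwards [self_mem_nhdsWithin] with a ha
    rw [smul_zero, add_zero]
    refine key _ (ht.add_smul hu a) ?_
    rw [dotProduct_add, hvt, zero_add, dotProduct_smul]
    exact mul_ne_zero ha hvu
  · exact key t ht hvt

theorem mem_lineDeg_of_eventually {C : Finset E} {η u : Fin n → ℝ} {D : ℕ}
    {g : MvPolynomial (Fin n) ℂ} (h : ∀ᶠ a in 𝓝[≠] (0 : ℝ), g ∈ lineDeg V C (η + a • u) D) :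
    g ∈ lineDeg V C η D := by
  rw [mem_lineDeg]
  intro t ht
  refine lineP_mem_degreeLT_of_eventually (u := 0) (w := u) (h.mono fun a ha => ?_)
  rw [smul_zero, add_zero]
  exact mem_lineDeg.1 ha t ht

end Lines

/-! ### Spaces defined by directional degree bounds -/

section DegSpace

variable {E : Type*} {n : ℕ} {V : E → Fin n → ℝ}

/-- The polynomials whose restrictions to the lines in direction `η` in the orthogonal complement of
`C` have degree less than `D η`, for all `η`. -/
noncomputable def degSpace (V : E → Fin n → ℝ) (C : Finset E) (D : (Fin n → ℝ) → ℕ) :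
    Submodule ℂ (MvPolynomial (Fin n) ℂ) :=
  ⨅ η : {η // Perp V C η}, lineDeg V C η (D η)

theorem mem_degSpace {C : Finset E} {D : (Fin n → ℝ) → ℕ} {f : MvPolynomial (Fin n) ℂ} :
    f ∈ degSpace V C D ↔ ∀ η, Perp V C η → f ∈ lineDeg V C η (D η) := by
  simp [degSpace, Submodule.mem_iInf]

theorem formIdeal_le_degSpace (C : Finset E) (D : (Fin n → ℝ) → ℕ) :
    (formIdeal V C).restrictScalars ℂ ≤ degSpace V C D := fun _ hf =>
  mem_degSpace.2 fun _ hη => formIdeal_le_lineDeg hη _ hf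

theorem degSpace_mono {C C' : Finset E} (hC : C ⊆ C') {D D' : (Fin n → ℝ) → ℕ}
    (hD : ∀ η, Perp V C' η → D η ≤ D' η) : degSpace V C D ≤ degSpace V C' D' := fun _ hf =>
  mem_degSpace.2 fun η hη => lineDeg_mono hC (hD η hη) (mem_degSpace.1 hf η (hη.mono hC))

theorem eval_zero_lineP (t η : Fin n → ℝ) (f : MvPolynomial (Fin n) ℂ) :
    (lineP t η f).eval 0 = evalAt t f := by
  induction f using MvPolynomial.induction_on with
  | C a => simp [lineP, evalAt]
  | add p q hp hq =>
    rw [map_add, Polynomial.eval_add, hp, hq]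
    exact (map_add _ _ _).symm
  | mul_X p i hp =>
    rw [map_mul, Polynomial.eval_mul, hp, evalAt_mul]
    congr 1
    simp [lineP, evalAt]

theorem mem_formIdeal_of_degSpace_zero {C : Finset E} {f : MvPolynomial (Fin n) ℂ}
    (hf : f ∈ degSpace V C fun _ => 0) : f ∈ formIdeal V C := by
  refine mem_formIdeal_of_evalAt fun t ht => ?_
  have h := mem_lineDeg.1 (mem_degSpace.1 hf 0 fun c _ => dotProduct_zero _) t ht
  rw [← eval_zero_lineP t 0 f]
  have h0 : lineP t 0 f = 0 := by
    ext j
    exact mem_degreeLT_iff.1 h j (Nat.zero_le j)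
  rw [h0, Polynomial.eval_zero]

/-- With a bound independent of η, directions with v · η = 0 are limits of directions with v · η ≠
0, so the degree drops by one in all of them. -/
theorem mem_degSpace_of_linForm_mul_const {C : Finset E} {v : Fin n → ℝ} (hv : v ∉ spanOf V C)
    {D : ℕ} {g : MvPolynomial (Fin n) ℂ} (h : linForm v * g ∈ degSpace V C fun _ => D) :
    g ∈ degSpace V C fun _ => D - 1 := by
  obtain ⟨u, hu, hvu⟩ := exists_perp_ne_zero hv
  rw [mem_degSpace] at *
  intro η hη
  by_cases hvη : v ⬝ᵥ η = 0
  · refine mem_lineDeg_of_eventually (u := u) ?_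
    filter_upwards [self_mem_nhdsWithin] with a ha
    refine mem_lineDeg_of_linForm_mul (v := v) ?_ (h _ (hη.add_smul hu a))
    rw [dotProduct_add, hvη, zero_add, dotProduct_smul]
    exact mul_ne_zero ha hvu
  · exact mem_lineDeg_of_linForm_mul hvη (h η hη)

/-- The deletion-contraction step. -/
theorem mem_minorSpan_sup_of_step [DecidableEq E] {s : E → E → Prop} [IsStrictTotalOrder E s]
    {𝔹 : Set (Finset E)} {L C : Finset E} {a : E} (hL : IsUpper s L) (ha : IsLeast' s L a)
    (hd : Disjoint C L) (hsp : V a ∉ spanOf V C) {G : Submodule ℂ (MvPolynomial (Fin n) ℂ)}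
    (hgen : minorSpan V s 𝔹 L C ≤ G) (hform : (formIdeal V C).restrictScalars ℂ ≤ G)
    {f : MvPolynomial (Fin n) ℂ} (hf : f ∈ G)
    (h1 : f ∈ minorSpan V s 𝔹 (L.erase a) (insert a C) ⊔
      (formIdeal V (insert a C)).restrictScalars ℂ)
    (h2 : ∀ g, linForm (V a) * g ∈ G →
      g ∈ minorSpan V s 𝔹 (L.erase a) C ⊔ (formIdeal V C).restrictScalars ℂ) :
    f ∈ minorSpan V s 𝔹 L C ⊔ (formIdeal V C).restrictScalars ℂ := by
  -- Contraction handles f up to a multiple p_a g. Since G contains f, w and the ideal of C, also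
  -- p_a g ∈ G, so the deletion hypothesis applies to g.
  obtain ⟨w, hw, j, hj, rfl⟩ := Submodule.mem_sup.1 h1
  replace hw := minorSpan_erase_insert_le hL ha hd hw
  obtain ⟨g, hg⟩ := exists_of_mem_formIdeal_insert hj
  have hag : linForm (V a) * g ∈ G := by
    have := sub_mem (sub_mem hf (hgen hw)) (hform hg)
    convert this using 1
    ring
  obtain ⟨w', hw', j', hj', rfl⟩ := Submodule.mem_sup.1 (h2 g hag)
  refine Submodule.mem_sup.2 ⟨w + linForm (V a) * w',
    add_mem hw (linForm_mul_mem_minorSpan hL ha hd hsp hw'),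
    j - linForm (V a) * (w' + j') + linForm (V a) * j', add_mem hg (Ideal.mul_mem_left _ _ hj'), ?_⟩
  ring

end DegSpace

/-! ### The induction over Y -/

section Tail

variable {ι : Type*} {n M : ℕ} {x : ι → Fin n → ℝ} {y : Fin M → Fin n → ℝ}
  {k : Finset ι → ℕ} {r : ι → ι → Prop}

theorem toLeft_eq_of_below {L B C : Finset (ι ⊕ Fin M)} (hL : ∀ a, Sum.inl a ∉ L)
    (h : ∀ e, e ∈ C ↔ e ∈ B ∧ e ∉ L) : B.toLeft = C.toLeft := by
  ext a
  simp [h, hL]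

variable [Fintype ι]

theorem activeIn_subset_activeSet {L B : Finset (ι ⊕ Fin M)} :
    activeIn (joint x y) (Sum.Lex r (· < ·)) L B ⊆ activeSet x y r B := by
  intro z hz
  rw [mem_activeIn] at hz
  exact mem_activeSet.2 hz.2

/-- The active vectors in L and the n - #C elements of B ∩ L are disjoint and both among the y_i
with j ≤ i < m(C ∩ X). -/
theorem card_activeIn_tail_le {j : ℕ} {L B C : Finset (ι ⊕ Fin M)} (hLl : ∀ a, Sum.inl a ∉ L)
    (hLr : ∀ i, Sum.inr i ∈ L ↔ j ≤ (i : ℕ)) (hB : B ∈ basisSet x y k)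
    (h : ∀ e, e ∈ C ↔ e ∈ B ∧ e ∉ L) :
    (activeIn (joint x y) (Sum.Lex r (· < ·)) L B).card + n ≤
      extNum n k C.toLeft - j + C.card := by
  classical
  set A := activeIn (joint x y) (Sum.Lex r (· < ·)) L B with hA
  have hC : B.filter (· ∉ L) = C := by
    ext e
    rw [Finset.mem_filter, h]
  have h1 := Finset.card_filter_add_card_filter_not (s := B) (· ∈ L)
  rw [hC, hB.1.card_eq] at h1
  have hdisj : Disjoint A (B.filter (· ∈ L)) := by
    rw [Finset.disjoint_left]
    intro z hz hzB
    exact (mem_activeIn.1 hz).2.1 (Finset.mem_filter.1 hzB).1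
  have hsub : A ∪ B.filter (· ∈ L) ⊆ (∅ : Finset ι).disjSum (Finset.univ.filter fun i : Fin M =>
      j ≤ (i : ℕ) ∧ (i : ℕ) < extNum n k C.toLeft) := by
    intro z hz
    have hzL : z ∈ L := (Finset.mem_union.1 hz).elim (fun h => (mem_activeIn.1 h).1)
      fun h => (Finset.mem_filter.1 h).2
    rcases z with a | i
    · exact absurd hzL (hLl a)
    · refine Finset.inr_mem_disjSum.2 (Finset.mem_filter.2 ⟨Finset.mem_univ i, (hLr i).1 hzL, ?_⟩)
      rw [← toLeft_eq_of_below hLl h]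
      rcases Finset.mem_union.1 hz with hz | hz
      · have := activeSet_toRight_subset hB
          (Finset.mem_toRight.2 (activeIn_subset_activeSet (hA ▸ hz)))
        exact (Finset.mem_filter.1 (Finset.mem_sdiff.1 this).1).2
      · exact hB.2 i (Finset.mem_toRight.2 (Finset.mem_filter.1 hz).1)
  have h2 := Finset.card_le_card hsub
  rw [Finset.card_union_of_disjoint hdisj, Finset.card_disjSum, Finset.card_empty, zero_add] at h2
  have h3 := card_filter_fin_le (M := M) j (extNum n k C.toLeft)
  omega

/-- Of the m(C ∩ X) - j vectors still available, m must go into the basis; the others number D - 1,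
which is the permitted degree. Contracting y_j lowers m by one and deleting it lowers D by one, so
the induction is on m + D. -/
theorem mem_minorSpan_sup_of_tail [IsStrictTotalOrder ι r] (hM : LongEnough x k M)
    (hy : GeneralPosition x y) (N : ℕ) : ∀ (j m D : ℕ) (L C : Finset (ι ⊕ Fin M)),
    (∀ a, Sum.inl a ∉ L) → (∀ i, Sum.inr i ∈ L ↔ j ≤ (i : ℕ)) → IsIndep (joint x y) C →
    Disjoint C L → C.card + m = n → j + m + D = extNum n k C.toLeft + 1 → m + D = N →
    ∀ f, f ∈ degSpace (joint x y) C (fun _ => D) →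
      f ∈ minorSpan (joint x y) (Sum.Lex r (· < ·)) (basisSet x y k) L C ⊔
        (formIdeal (joint x y) C).restrictScalars ℂ := by
  classical
  have : IsStrictTotalOrder (ι ⊕ Fin M) (Sum.Lex r (· < ·)) := { }
  induction N with
  | zero =>
    intro j m D L C _ _ _ _ _ _ hN f hf
    obtain rfl : D = 0 := by omega
    exact Submodule.mem_sup_right (mem_formIdeal_of_degSpace_zero hf)
  | succ N ih =>
    intro j m D L C hLl hLr hC hd hm hj hN f hf
    have hU : IsUpper (Sum.Lex r (· < ·)) L := by
      rintro e he (a | i) hw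
      · exact absurd hw (hLl a)
      · rcases e with a | i'
        · exact Sum.Lex.sep _ _
        · rw [hLr] at he hw
          exact Sum.Lex.inr (Fin.lt_def.2 (by omega))
    rcases Nat.eq_zero_or_pos D with rfl | hD
    · exact Submodule.mem_sup_right (mem_formIdeal_of_degSpace_zero hf)
    rcases Nat.eq_zero_or_pos m with rfl | hmpos
    · have hB := hC.isBasis (by omega)
      have hCL : ∀ e, e ∈ C ↔ e ∈ C ∧ e ∉ L := fun e =>
        ⟨fun h => ⟨h, Finset.disjoint_left.1 hd h⟩, fun h => h.1⟩
      have hCB : C ∈ basisSet x y k := by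
        refine ⟨hB, fun i hi => ?_⟩
        have := mt (hLr i).2 (Finset.disjoint_left.1 hd (Finset.mem_toRight.1 hi))
        omega
      have hA : activeIn (joint x y) (Sum.Lex r (· < ·)) L C = ∅ := by
        refine Finset.eq_empty_of_forall_notMem fun z hz => ?_
        obtain ⟨hzL, -, C', hC', hzC⟩ := mem_activeIn.1 hz
        obtain rfl : C' = C := by
          ext b
          rw [hC', and_iff_left_iff_imp]
          exact fun hb => hU b (Finset.disjoint_left.1 hd hb) z hzL
        exact hzC (hB.spanOf_eq_top ▸ Submodule.mem_top)
      have h1 := mem_minorSpan (V := joint x y) (s := Sum.Lex r (· < ·)) hCB hCL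
      rw [hA, pProd, Finset.prod_empty] at h1
      have h2 := sub_C_mem_ideal hB.spanOf_eq_top
        (fun c hc => linForm_mem_formIdeal hc) f
      refine Submodule.mem_sup.2 ⟨_, Submodule.smul_mem _ (constantCoeff f) h1, _, h2, ?_⟩
      rw [smul_eq_C_mul]
      ring
    -- As m and D are positive, j < m(C ∩ X), so the sequence Y is long enough to have a vector of
    -- index j.
    have hjM : j < M := by
      have := hM _ hC.toLeft
      omega
    set z : ι ⊕ Fin M := Sum.inr ⟨j, hjM⟩ with hz
    have hzL : z ∈ L := (hLr _).2 le_rfl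
    have hlt : IsLeast' (Sum.Lex r (· < ·)) L z := by
      refine ⟨hzL, ?_⟩
      rintro (a | i) hw hne
      · exact absurd hw (hLl a)
      · have hji := (hLr i).1 hw
        refine Sum.Lex.inr (lt_of_le_of_ne (Fin.le_def.2 hji) fun h => hne ?_)
        rw [hz, h]
    have hzC : z ∉ C := fun h => Finset.disjoint_left.1 hd h hzL
    have hsp : joint x y z ∉ spanOf (joint x y) C := hy ⟨j, hjM⟩ C hzC (by omega)
    have hLl' : ∀ a, Sum.inl a ∉ L.erase z := fun a h => hLl a (Finset.mem_of_mem_erase h)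
    have hLr' : ∀ i : Fin M, Sum.inr i ∈ L.erase z ↔ j + 1 ≤ (i : ℕ) := by
      intro i
      rw [Finset.mem_erase, hLr, hz, Ne, Sum.inr.injEq, Fin.ext_iff]
      change ¬ (i : ℕ) = j ∧ _ ↔ _
      omega
    have hd' : Disjoint C (L.erase z) := hd.mono_right (Finset.erase_subset z L)
    have hd1 : Disjoint (insert z C) (L.erase z) :=
      Finset.disjoint_insert_left.2 ⟨Finset.notMem_erase z L, hd'⟩
    have hleft : (insert z C).toLeft = C.toLeft := by
      ext a
      simp [hz]
    refine mem_minorSpan_sup_of_step hU hlt hd hsp (G := degSpace (joint x y) C fun _ => D) ?_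
      (formIdeal_le_degSpace _ _) hf ?_ ?_
    · refine Submodule.span_le.2 ?_
      rintro _ ⟨B, hB, h, rfl⟩
      refine mem_degSpace.2 fun η _ => ?_
      have hA := card_activeIn_tail_le (r := r) hLl hLr hB h
      rw [← Nat.sub_add_cancel hD]
      refine pProd_mem_lineDeg ((Finset.card_filter_le _ _).trans ?_)
      omega
    · refine ih (j + 1) (m - 1) D _ _ hLl' hLr' (hC.insert hsp) hd1 ?_ ?_ (by omega) f
        (degSpace_mono (Finset.subset_insert z C) (fun _ _ => le_rfl) hf)
      · rw [Finset.card_insert_of_notMem hzC]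
        omega
      · rw [hleft]
        omega
    · intro g hg
      exact ih (j + 1) m (D - 1) _ _ hLl' hLr' hC hd' hm (by omega) (by omega) g
        (mem_degSpace_of_linForm_mul_const hsp hg)

end Tail

/-! ### The induction over X and the dimension of P_k -/

section Head

open Filter Topology

variable {ι : Type*} {n M : ℕ} {x : ι → Fin n → ℝ} {y : Fin M → Fin n → ℝ}
  {k : Finset ι → ℕ} {r : ι → ι → Prop}

theorem spanOf_joint_of_inr_notMem {C : Finset (ι ⊕ Fin M)} (hC : ∀ i, Sum.inr i ∉ C) :
    spanOf (joint x y) C = spanOf x C.toLeft := by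
  refine le_antisymm (spanOf_le.2 ?_) (spanOf_le.2 fun a ha => ?_)
  · rintro (a | i) h
    · exact mem_spanOf (Finset.mem_toLeft.2 h)
    · exact absurd h (hC i)
  · exact mem_spanOf (V := joint x y) (Finset.mem_toLeft.1 ha)

variable [DecidableEq ι]

theorem Incremental.union_le (hinc : Incremental k) (A T : Finset ι) :
    k (A ∪ T) ≤ k A + T.card := by
  induction T using Finset.induction_on with
  | empty => simp
  | insert a T ha ih =>
    rw [Finset.union_insert, Finset.card_insert_of_notMem ha]
    have := hinc (A ∪ T) a
    omega

theorem Incremental.le_filter (hinc : Incremental k) (Z : Finset ι) (p : ι → Prop)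
    [DecidablePred p] : k Z ≤ k (Z.filter p) + (Z.filter fun a => ¬ p a).card := by
  conv_lhs => rw [← Finset.filter_union_filter_not_eq p Z]
  exact hinc.union_le _ _

/-- The bound for the degree in direction `η` after the contraction of `C`, where `L` is left. -/
noncomputable def headDeg (x : ι → Fin n → ℝ) (k : Finset ι → ℕ) (C L : Finset ι)
    (η : Fin n → ℝ) : ℕ :=
  k (C ∪ L.filter fun a => x a ⬝ᵥ η = 0) + (L.filter fun a => ¬ x a ⬝ᵥ η = 0).card + 1

theorem Solid.insert_eq (hk : Solid x k) {Z : Finset ι} {a : ι} (ha : x a ∈ spanOf x Z) :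
    k (insert a Z) = k Z :=
  le_antisymm (hk _ _ (spanOf_le.2 fun _ hb => (Finset.mem_insert.1 hb).elim
    (fun h => h ▸ ha) mem_spanOf)) (hk.mono (Finset.subset_insert a Z))

/-- If x_a · η ≠ 0, the degree and the count both drop by one. If x_a · η = 0, let S be the set in
the bound without a. For x_a ∈ Span S solidity leaves the bound unchanged. For x_a ∉ Span S, tilt η
slightly to a direction still orthogonal to S but not to x_a, apply the first case, and pass to the
limit. -/
theorem mem_degSpace_headDeg_erase (hk : Solid x k) {C L : Finset (ι ⊕ Fin M)} {a : ι}
    (haL : a ∈ L.toLeft) (hC : ∀ i, Sum.inr i ∉ C) (hsp : x a ∉ spanOf x C.toLeft)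
    {g : MvPolynomial (Fin n) ℂ}
    (h : linForm (x a) * g ∈ degSpace (joint x y) C (headDeg x k C.toLeft L.toLeft)) :
    g ∈ degSpace (joint x y) C (headDeg x k C.toLeft (L.toLeft.erase a)) := by
  rw [← spanOf_joint_of_inr_notMem (y := y) hC] at hsp
  rw [mem_degSpace] at *
  set L₀ := L.toLeft.erase a with hL₀
  have hL : L.toLeft = insert a L₀ := (Finset.insert_erase haL).symm
  have haL₀ : a ∉ L₀ := Finset.notMem_erase a _
  rw [hL] at h
  have key : ∀ η, Perp (joint x y) C η → ¬ x a ⬝ᵥ η = 0 →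
      g ∈ lineDeg (joint x y) C η (headDeg x k C.toLeft L₀ η) := by
    intro η hη hne
    have h1 := mem_lineDeg_of_linForm_mul hne (h η hη)
    rw [headDeg, Finset.filter_insert, if_neg hne, Finset.filter_insert, if_pos hne,
      Finset.card_insert_of_notMem fun h => haL₀ (Finset.mem_filter.1 h).1] at h1
    exact h1
  intro η hη
  by_cases hη0 : x a ⬝ᵥ η = 0
  · set S := C.toLeft ∪ L₀.filter fun b => x b ⬝ᵥ η = 0 with hS
    by_cases haS : x a ∈ spanOf x S
    · have h1 := mem_lineDeg_of_linForm_mul_of_eq_zero hη0 hsp (h η hη)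
      rw [headDeg, Finset.filter_insert, if_pos hη0, Finset.filter_insert,
        if_neg (not_not.2 hη0), Finset.union_insert, hk.insert_eq haS] at h1
      exact h1
    · obtain ⟨u, hu, hau⟩ := exists_perp_ne_zero haS
      have huC : Perp (joint x y) C u := by
        rintro (c | i) hc
        · exact hu c (Finset.mem_union_left _ (Finset.mem_toLeft.2 hc))
        · exact absurd hc (hC i)
      refine mem_lineDeg_of_eventually (u := u) ?_
      -- For small s the tilted direction is orthogonal to the same vectors of L ∖ a as η, so the
      -- bound for L ∖ a is constant along the limit.
      have hev : ∀ᶠ s in 𝓝[≠] (0 : ℝ), ∀ b ∈ L₀, ¬ x b ⬝ᵥ η = 0 → ¬ x b ⬝ᵥ (η + s • u) = 0 := by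
        rw [Filter.eventually_all_finset]
        intro b _
        by_cases hb : x b ⬝ᵥ η = 0
        · exact Eventually.of_forall fun _ h => absurd hb h
        · have hc : Continuous fun s : ℝ => x b ⬝ᵥ (η + s • u) := by
            simp only [dotProduct_add, dotProduct_smul]
            fun_prop
          have := hc.continuousAt.eventually_ne (x := 0) (y := 0) (by simpa using hb)
          exact (this.filter_mono nhdsWithin_le_nhds).mono fun s hs _ => hs
      filter_upwards [hev, self_mem_nhdsWithin] with s hs hs0
      have hiff : ∀ b ∈ L₀, (x b ⬝ᵥ (η + s • u) = 0 ↔ x b ⬝ᵥ η = 0) := by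
        refine fun b hb => ⟨fun h => by_contra fun h' => hs b hb h' h, fun h => ?_⟩
        rw [dotProduct_add, dotProduct_smul, h,
          hu b (Finset.mem_union_right _ (Finset.mem_filter.2 ⟨hb, h⟩)), smul_zero, add_zero]
      have h1 := key (η + s • u) (hη.add_smul huC s) (by
        rw [dotProduct_add, hη0, zero_add, dotProduct_smul]
        exact mul_ne_zero hs0 hau)
      rw [headDeg, Finset.filter_congr hiff,
        Finset.filter_congr fun b hb => not_congr (hiff b hb)] at h1
      exact h1
  · exact key η hη hη0

variable [Fintype ι]

/-- The active vectors of Y number at most k(B ∩ X), which by incrementality is at most k of the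
part orthogonal to η plus the number of the other vectors of B ∩ X. These others lie in L, as η ⟂ C,
and are disjoint from the active ones. -/
theorem pProd_activeIn_mem_degSpace (hk : Solid x k) (hinc : Incremental k)
    (hM : LongEnough x k M) {B C L : Finset (ι ⊕ Fin M)} (hB : B ∈ basisSet x y k)
    (h : ∀ e, e ∈ C ↔ e ∈ B ∧ e ∉ L) :
    pProd (joint x y) (activeIn (joint x y) (Sum.Lex r (· < ·)) L B) ∈
      degSpace (joint x y) C (headDeg x k C.toLeft L.toLeft) := by
  refine mem_degSpace.2 fun η hη => pProd_mem_lineDeg ?_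
  set A := activeIn (joint x y) (Sum.Lex r (· < ·)) L B with hA
  set F := A.filter fun z => ¬ joint x y z ⬝ᵥ η = 0 with hF
  have hR : F.toRight.card ≤ k B.toLeft := by
    rw [← card_filter_sdiff_toRight hM hB]
    refine Finset.card_le_card fun i hi => activeSet_toRight_subset (r := r) hB ?_
    exact Finset.mem_toRight.2 (activeIn_subset_activeSet
      (Finset.mem_filter.1 (Finset.mem_toRight.1 hi)).1)
  have hI := hinc.le_filter B.toLeft fun a => x a ⬝ᵥ η = 0
  have hsub : (B.toLeft.filter fun a => x a ⬝ᵥ η = 0) ⊆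
      C.toLeft ∪ L.toLeft.filter fun a => x a ⬝ᵥ η = 0 := by
    intro a ha
    obtain ⟨haB, ha0⟩ := Finset.mem_filter.1 ha
    rw [Finset.mem_union, Finset.mem_toLeft, h, Finset.mem_filter, Finset.mem_toLeft]
    by_cases haL : Sum.inl a ∈ L
    · exact Or.inr ⟨haL, ha0⟩
    · exact Or.inl ⟨Finset.mem_toLeft.1 haB, haL⟩
  have hmono := hk.mono hsub
  have hdisj : Disjoint F.toLeft (B.toLeft.filter fun a => ¬ x a ⬝ᵥ η = 0) := by
    rw [Finset.disjoint_left]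
    intro a ha haB
    exact (mem_activeIn.1 (Finset.mem_filter.1 (Finset.mem_toLeft.1 ha)).1).2.1
      (Finset.mem_toLeft.1 (Finset.mem_filter.1 haB).1)
  have hunion : F.toLeft ∪ (B.toLeft.filter fun a => ¬ x a ⬝ᵥ η = 0) ⊆
      L.toLeft.filter fun a => ¬ x a ⬝ᵥ η = 0 := by
    intro a ha
    rw [Finset.mem_filter, Finset.mem_toLeft]
    rcases Finset.mem_union.1 ha with ha | ha
    · obtain ⟨haA, ha0⟩ := Finset.mem_filter.1 (Finset.mem_toLeft.1 ha)
      exact ⟨(mem_activeIn.1 haA).1, ha0⟩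
    · obtain ⟨haB, ha0⟩ := Finset.mem_filter.1 ha
      refine ⟨by_contra fun haL => ha0 ?_, ha0⟩
      exact hη (Sum.inl a) ((h _).2 ⟨Finset.mem_toLeft.1 haB, haL⟩)
  have hcard := Finset.card_le_card hunion
  rw [Finset.card_union_of_disjoint hdisj] at hcard
  have hFc : F.toLeft.card + F.toRight.card = F.card := Finset.card_toLeft_add_card_toRight
  change F.card ≤ _
  omega

theorem mem_minorSpan_sup_of_head [IsStrictTotalOrder ι r] (hk : Solid x k)
    (hinc : Incremental k) (hM : LongEnough x k M) (hy : GeneralPosition x y) (m : ℕ) :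
    ∀ L C : Finset (ι ⊕ Fin M), L.toLeft.card = m → (∀ i, Sum.inr i ∈ L) →
    IsUpper (Sum.Lex r (· < ·)) L → Disjoint C L → IsIndep (joint x y) C →
    ∀ f, f ∈ degSpace (joint x y) C (headDeg x k C.toLeft L.toLeft) →
      f ∈ minorSpan (joint x y) (Sum.Lex r (· < ·)) (basisSet x y k) L C ⊔
        (formIdeal (joint x y) C).restrictScalars ℂ := by
  have : IsStrictTotalOrder (ι ⊕ Fin M) (Sum.Lex r (· < ·)) := { }
  induction m with
  | zero =>
    intro L C hm hL _ hd hC f hf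
    have hL0 := Finset.card_eq_zero.1 hm
    have hCr : C.toRight = ∅ := Finset.eq_empty_of_forall_notMem fun i hi =>
      Finset.disjoint_left.1 hd (Finset.mem_toRight.1 hi) (hL i)
    have hcard : C.toLeft.card + C.toRight.card = C.card := Finset.card_toLeft_add_card_toRight
    rw [hCr, Finset.card_empty, add_zero] at hcard
    have hle := hC.card_le
    have hf' : f ∈ degSpace (joint x y) C fun _ => k C.toLeft + 1 := by
      refine degSpace_mono subset_rfl (fun η _ => ?_) hf
      simp [headDeg, hL0]
    -- Once X is exhausted the bound is the constant k(C) + 1, with C ⊆ X, and m(C) + 1 = (n - #C) +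
    -- (k(C) + 1) matches the invariant with j = 0.
    refine mem_minorSpan_sup_of_tail hM hy _ 0 (n - C.card) (k C.toLeft + 1) L C (fun a ha => ?_)
      (fun i => by simp [hL]) hC hd (by omega) ?_ rfl f hf'
    · have := Finset.mem_toLeft.2 ha
      simp [hL0] at this
    · rw [extNum, hcard]
      omega
  | succ m ih =>
    intro L C hm hL hU hd hC f hf
    have hCr : ∀ i, Sum.inr i ∉ C := fun i hi => Finset.disjoint_left.1 hd hi (hL i)
    obtain ⟨b, hb⟩ := Finset.card_pos.1 (by omega : 0 < L.toLeft.card)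
    obtain ⟨z, hz⟩ := exists_isLeast' (Sum.Lex r (· < ·)) ⟨_, Finset.mem_toLeft.1 hb⟩
    obtain ⟨a, rfl⟩ : ∃ a, z = Sum.inl a := by
      rcases z with a | i
      · exact ⟨a, rfl⟩
      · have := hz.lt _ (Finset.mem_toLeft.1 hb) (by simp)
        cases this
    have haL : a ∈ L.toLeft := Finset.mem_toLeft.2 hz.mem
    have hleft : (L.erase (Sum.inl a)).toLeft = L.toLeft.erase a := by
      ext e
      simp
    have hm' : (L.erase (Sum.inl a)).toLeft.card = m := by
      rw [hleft, Finset.card_erase_of_mem haL, hm, Nat.add_sub_cancel]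
    have hL' : ∀ i, Sum.inr i ∈ L.erase (Sum.inl a) := fun i => by simp [hL]
    have hU' := hU.erase hz
    have hd' : Disjoint C (L.erase (Sum.inl a)) := hd.mono_right (Finset.erase_subset _ L)
    have ih2 := ih _ C hm' hL' hU' hd' hC
    by_cases hsp : joint x y (Sum.inl a) ∈ spanOf (joint x y) C
    · refine (sup_le_sup_right (minorSpan_erase_le_of_mem_spanOf (fun B hB => hB.1) hU hz hd hsp) _)
        (ih2 f (degSpace_mono subset_rfl (fun η hη => ?_) hf))
      have h0 : x a ⬝ᵥ η = 0 := hη.dotProduct_eq_zero hsp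
      rw [spanOf_joint_of_inr_notMem hCr] at hsp
      rw [hleft]
      conv_lhs => rw [← Finset.insert_erase haL]
      rw [headDeg, headDeg, Finset.filter_insert, if_pos h0, Finset.filter_insert,
        if_neg (not_not.2 h0), Finset.union_insert,
        hk.insert_eq (spanOf_mono Finset.subset_union_left hsp)]
    · have hCleft : (insert (Sum.inl a) C).toLeft = insert a C.toLeft := by
        ext e
        simp
      refine mem_minorSpan_sup_of_step hU hz hd hsp
        (G := degSpace (joint x y) C (headDeg x k C.toLeft L.toLeft)) ?_
        (formIdeal_le_degSpace _ _) hf ?_ fun g hg => ih2 g ?_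
      · refine Submodule.span_le.2 ?_
        rintro _ ⟨B, hB, h, rfl⟩
        exact pProd_activeIn_mem_degSpace hk hinc hM hB h
      · refine ih _ _ hm' hL' hU'
          (Finset.disjoint_insert_left.2 ⟨Finset.notMem_erase _ L, hd'⟩) (hC.insert hsp) f
          (degSpace_mono (Finset.subset_insert _ C) (fun η hη => ?_) hf)
        -- For η orthogonal to a, moving a from L to C does not change the argument of k in the
        -- bound.
        have h0 : x a ⬝ᵥ η = 0 := hη _ (Finset.mem_insert_self _ C)
        rw [hleft, hCleft]
        conv_lhs => rw [← Finset.insert_erase haL]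
        rw [headDeg, headDeg, Finset.filter_insert, if_pos h0, Finset.filter_insert,
          if_neg (not_not.2 h0), Finset.union_insert, Finset.insert_union]
      · rw [hleft]
        rw [spanOf_joint_of_inr_notMem hCr] at hsp
        exact mem_degSpace_headDeg_erase hk haL hCr hsp hg

/-- Along η, p_{X ∖ Z} g has degree at most #((X ∖ Z) ∖ η^⊥) + k(Z), and incrementality trades k(Z)
for k(Z ∩ η^⊥) + #(Z ∖ η^⊥), which makes the bound independent of Z. -/
theorem pSpace_le_degSpace (hk : Solid x k) (hinc : Incremental k) :
    pSpace x k ≤ degSpace (joint x y) ∅ (headDeg x k ∅ Finset.univ) := by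
  refine iSup_le fun Z => ?_
  rintro _ ⟨g, hg, rfl⟩
  refine mem_degSpace.2 fun η _ => mem_lineDeg.2 fun t _ => mem_degreeLT_of_natDegree_le ?_
  rw [LinearMap.mulLeft_apply, map_mul]
  refine Polynomial.natDegree_mul_le.trans ((add_le_add (natDegree_lineP_pProd_le t η x _)
    ((natDegree_lineP_le t η g).trans ((mem_restrictTotalDegree _ _ _).1 hg))).trans ?_)
  have h1 := hinc.le_filter Z fun a => x a ⬝ᵥ η = 0
  have h2 : k (Z.filter fun a => x a ⬝ᵥ η = 0) ≤
      k (∅ ∪ Finset.univ.filter fun a => x a ⬝ᵥ η = 0) :=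
    hk.mono ((Finset.filter_subset_filter _ (Finset.subset_univ Z)).trans Finset.subset_union_right)
  have h3 : ((Finset.univ \ Z).filter fun a => ¬ x a ⬝ᵥ η = 0).card +
      (Z.filter fun a => ¬ x a ⬝ᵥ η = 0).card =
        (Finset.univ.filter fun a => ¬ x a ⬝ᵥ η = 0).card := by
    rw [← Finset.card_union_of_disjoint (Finset.disjoint_filter_filter Finset.sdiff_disjoint),
      ← Finset.filter_union, Finset.sdiff_union_of_subset (Finset.subset_univ Z)]
  change ((Finset.univ \ Z).filter fun a => ¬ x a ⬝ᵥ η = 0).card + k Z ≤ _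
  omega

theorem finrank_pSpace (hk : Solid x k) (hinc : Incremental k) (hM : LongEnough x k M)
    (hy : GeneralPosition x y) :
    Module.finrank ℂ (pSpace x k) = (basisSet x y k).ncard := by
  obtain ⟨r, hr⟩ := exists_isStrictTotalOrder ι
  suffices pSpace x k ≤ Submodule.span ℂ (Set.range fun B : {B // B ∈ basisSet x y k} =>
      pProd (joint x y) (activeSet x y r B)) by
    rw [le_antisymm this (span_activeSet_le hk hM r), finrank_span_activeSet hk hy r]
  intro f hf
  have h1 := mem_minorSpan_sup_of_head (r := r) hk hinc hM hy _ Finset.univ ∅ rfl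
    (fun i => Finset.mem_univ _) (fun e he => absurd (Finset.mem_univ e) he)
    (Finset.disjoint_empty_left _) isIndep_empty f (by
      have h1 : (∅ : Finset (ι ⊕ Fin M)).toLeft = ∅ := rfl
      have h2 : (Finset.univ : Finset (ι ⊕ Fin M)).toLeft = Finset.univ := by
        ext a
        simp
      rw [h1, h2]
      exact pSpace_le_degSpace hk hinc hf)
  -- With nothing contracted the error ideal is zero, so membership modulo the ideal becomes
  -- membership in the span.
  have h0 : formIdeal (joint x y) (∅ : Finset (ι ⊕ Fin M)) = ⊥ := by
    simp [formIdeal]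
  rw [h0, Submodule.restrictScalars_bot, sup_bot_eq] at h1
  refine Submodule.span_le.2 ?_ h1
  rintro _ ⟨B, hB, -, rfl⟩
  exact Submodule.subset_span ⟨⟨B, hB⟩, congrArg _ (activeSet_eq r B)⟩

end Head

end Zonotopal

theorem mainTheorem3 {ι : Type*} [Fintype ι] [DecidableEq ι] {n M : ℕ}
    (x : ι → Fin n → ℝ) (y : Fin M → Fin n → ℝ) (k : Finset ι → ℕ)
    (hk : Zonotopal.Solid x k) (hM : Zonotopal.LongEnough x k M)
    (hy : Zonotopal.GeneralPosition x y) :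
    (Zonotopal.Incremental k →
      Module.finrank ℂ (Zonotopal.pSpace x k) = (Zonotopal.basisSet x y k).ncard) ∧
    (Module.finrank ℂ (Zonotopal.pSpace x k) = (Zonotopal.basisSet x y k).ncard →
      -- the direct sum decomposition, and the duality of the two spaces under the pairing
      IsCompl (Zonotopal.pSpace x k) ((Zonotopal.jIdeal x y k).restrictScalars ℂ) ∧
      Function.Bijective ((Zonotopal.pairing n).domRestrict₁₂
        (Zonotopal.pSpace x k) (Zonotopal.dSpace x y k)) ∧
      -- the homogeneous basis, for any total order of `X`
      (∀ r : ι → ι → Prop, IsStrictTotalOrder ι r →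
        (∀ B ∈ Zonotopal.basisSet x y k,
          (Zonotopal.pProd (Zonotopal.joint x y) (Zonotopal.activeSet x y r B)).IsHomogeneous
            (Zonotopal.activeSet x y r B).card) ∧
        Zonotopal.IsBasisOf
          (fun B : {B // B ∈ Zonotopal.basisSet x y k} =>
            Zonotopal.pProd (Zonotopal.joint x y) (Zonotopal.activeSet x y r B))
          (Zonotopal.pSpace x k)) ∧
      -- the Lagrange basis, for any generic constants
      (∀ c : ι ⊕ Fin M → ℝ, Zonotopal.Generic (Zonotopal.joint x y) c →
        (∀ B B' : {B // B ∈ Zonotopal.basisSet x y k},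
          Zonotopal.evalAt (B'.2.1.vertex c) (Zonotopal.lagrange x y k c B) = 0 ↔ B' ≠ B) ∧
        Zonotopal.IsBasisOf (Zonotopal.lagrange x y k c) (Zonotopal.pSpace x k))) := by
  refine ⟨fun hinc => Zonotopal.finrank_pSpace hk hinc hM hy, fun hdim => ?_⟩
  have hcompl := Zonotopal.isCompl_pSpace_jIdeal hk hM hy hdim
  refine ⟨hcompl, Zonotopal.bijective_pairing hcompl, fun r hr => ⟨fun B _ => ?_, ?_, ?_⟩,
    fun c hc => ⟨Zonotopal.evalAt_lagrange_eq_zero_iff hk hM hc,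
      Zonotopal.isBasisOf_lagrange hk hM hdim hc⟩⟩
  · exact Zonotopal.isHomogeneous_pProd _ _
  · exact Zonotopal.linearIndependent_activeSet hk hy r
  · exact Zonotopal.span_activeSet_eq hk hM hy hdim r
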